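/- Let $R$ be the reversal map on finite binary words, $E$ the exchange antimorphism ($E(w)$ is the reversal of $w$ with the letters $0$ and $1$ interchanged), and for $\vartheta\in\{R,E\}$ call $w$ a $\vartheta$-palindrome if $\vartheta(w)=w$; an $R$-palindrome is simply called a palindrome. Let $w^{\vartheta}$ denote the shortest $\vartheta$-palindrome having $w$ as a prefix. Let $\vartheta_1\vartheta_2\vartheta_3\cdots=(EERR)^{\omega}$, $w_0=\varepsilon$, $w_{n+1}=(w_n1)^{\vartheta_{n+1}}$, and let $\mathbf u_p=\mathbf u(1^\omega,(EERR)^\omega)$ be the infinite binary word having every $w_n$ as a prefix. A factor $v$ of $\mathbf u_p$ is bispecial if $0v,1v,v0,v1$ are all factors of $\mathbf u_p$; a bispecial factor $v$ is weak if the set of factors of $\mathbf u_p$ of the form $avb$ with $a,b\in\{0,1\}$ is either $\{0v1,1v0\}$ or $\{0v0,1v1\}$. For $k\ge 1$ put $$s_{4k+1}=R(w_{4(k-1)+1})\,w_{4(k-1)}^{-1}\,w_{4(k-1)+3}\,w_{4(k-1)}^{-1}\,w_{4(k-1)+1},$$ $$s_{4k+3}=E(w_{4(k-1)+3})\,w_{4k-2}^{-1}\,w_{4k+1}\,w_{4k-2}^{-1}\,w_{4(k-1)+3},$$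 where $w^{-1}z$ denotes the word obtained from $z$ by deleting its prefix $w$. Then for every $k\ge 2$ the word $s_{2k+1}$ is a weak bispecial factor of $\mathbf u_p$; it is a palindrome if $k$ is even and an $E$-palindrome if $k$ is odd. Moreover, the weak bispecial factors of $\mathbf u_p$ are exactly the words $s_{2k+1}$, $R(s_{2k+1})$ and $E(s_{2k+1})$ with $k\ge 2$. -/

import Mathlib

namespace Pseudostandard

/-- Finite binary words; the letter `0` is `false` and the letter `1` is `true`. -/
abbrev Word := List Bool

/-- The two involutory antimorphisms of the binary free monoid: `R` is the reversal, `E` is the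
exchange antimorphism. -/
inductive Anti where
  | R : Anti
  | E : Anti

/-- The action of an antimorphism on words. -/
def Anti.app : Anti → Word → Word
  | Anti.R, w => w.reverse
  | Anti.E, w => (w.map not).reverse

theorem Anti.app_append (t : Anti) (v w : Word) : t.app (v ++ w) = t.app w ++ t.app v := by
  cases t <;> simp [Anti.app]

theorem Anti.app_app (t : Anti) (w : Word) : t.app (t.app w) = w := by
  cases t
  · simp [Anti.app]
  · have h : (not ∘ not) = id := by
      funext b
      simp
    simp [Anti.app, h]

theorem Anti.length_app (t : Anti) (w : Word) : (t.app w).length = w.length := by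
  cases t <;> simp [Anti.app]

/-- `w` is a palindrome (`t = R`), resp. an `E`-palindrome (`t = E`). -/
def IsPal (t : Anti) (w : Word) : Prop := t.app w = w

instance (t : Anti) (w : Word) : Decidable (IsPal t w) := inferInstanceAs (Decidable (_ = _))

theorem exists_isPal_append (t : Anti) (w : Word) : ∃ i, IsPal t (w ++ t.app (w.take i)) :=
  ⟨w.length, by simp [IsPal, Anti.app_append, Anti.app_app]⟩

/-- The (generalized) pseudopalindromic closure of `w`: the shortest `t`-palindrome having `w` as
a prefix. It is obtained by appending to `w` the image of its shortest prefix that makes the result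
a `t`-palindrome; `closure_isPal`, `prefix_closure` and `closure_shortest` show that this is the
unique shortest `t`-palindrome with prefix `w`. -/
def closure (t : Anti) (w : Word) : Word :=
  w ++ t.app (w.take (Nat.find (exists_isPal_append t w)))

theorem closure_isPal (t : Anti) (w : Word) : IsPal t (closure t w) :=
  Nat.find_spec (exists_isPal_append t w)

theorem prefix_closure (t : Anti) (w : Word) : w <+: closure t w :=
  List.prefix_append _ _

theorem closure_shortest (t : Anti) (w v : Word) (hv : IsPal t v) (hw : w <+: v) :
    (closure t w).length < v.length ∨ v = closure t w := by
  obtain ⟨x, rfl⟩ := hw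
  have hlen : (closure t w).length ≤ w.length + Nat.find (exists_isPal_append t w) := by
    simp [closure, Anti.length_app]
  have hlen' : (closure t w).length ≤ w.length + w.length := by
    simp [closure, Anti.length_app]
  by_cases hx : x.length ≤ w.length
  · have h1 : x = t.app (w.take x.length) := by
      have h := hv
      unfold IsPal at h
      rw [Anti.app_append] at h
      have h2 := congrArg (List.take x.length) h
      rw [List.take_append_of_le_length (by rw [Anti.length_app]),
        List.take_append_of_le_length hx,
        List.take_of_length_le (by rw [Anti.length_app])] at h2
      rw [← h2, Anti.app_app]
    have h3 : Nat.find (exists_isPal_append t w) ≤ x.length :=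
      Nat.find_min' _ (by rw [← h1]; exact hv)
    rcases h3.lt_or_eq with h | h
    · left
      rw [List.length_append]
      omega
    · right
      rw [closure, h, ← h1]
  · left
    rw [List.length_append]
    omega

/-- The prefixes `w_n` of the generalized pseudostandard word with directive bi-sequence `(Δ, Θ)`:
`w_0` is empty and `w_{n+1}` is the closure of `w_n δ_{n+1}` with respect to `ϑ_{n+1}`. The
sequences are indexed from `0` here: `Δ n` is `δ_{n+1}` and `Θ n` is `ϑ_{n+1}`. -/
def pref (Δ : ℕ → Bool) (Θ : ℕ → Anti) : ℕ → Word
  | 0 => []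
  | n + 1 => closure (Θ n) (pref Δ Θ n ++ [Δ n])

theorem pref_prefix_of_le (Δ : ℕ → Bool) (Θ : ℕ → Anti) {m n : ℕ} (h : m ≤ n) :
    pref Δ Θ m <+: pref Δ Θ n := by
  induction n, h using Nat.le_induction with
  | base => exact List.prefix_rfl
  | succ n _ ih =>
    exact ih.trans ((List.prefix_append _ _).trans (prefix_closure _ _))

theorem le_length_pref (Δ : ℕ → Bool) (Θ : ℕ → Anti) (n : ℕ) : n ≤ (pref Δ Θ n).length := by
  induction n with
  | zero => exact Nat.zero_le _
  | succ n ih =>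
    have h := (prefix_closure (Θ n) (pref Δ Θ n ++ [Δ n])).length_le
    rw [List.length_append, List.length_singleton] at h
    exact (Nat.succ_le_succ ih).trans h

/-- The generalized pseudostandard word `u(Δ, Θ)`: the infinite word having every `w_n` as a prefix
(see `word_eq`). Its letter at position `i` is read off from `w_{i+1}`, which has length at
least `i + 1`. -/
def word (Δ : ℕ → Bool) (Θ : ℕ → Anti) (i : ℕ) : Bool :=
  (pref Δ Θ (i + 1))[i]'(le_length_pref Δ Θ (i + 1))

theorem word_eq (Δ : ℕ → Bool) (Θ : ℕ → Anti) (n i : ℕ) (hi : i < (pref Δ Θ n).length) :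
    word Δ Θ i = (pref Δ Θ n)[i] := by
  rcases le_total n (i + 1) with h | h
  · exact ((pref_prefix_of_le Δ Θ h).getElem hi).symm
  · exact (pref_prefix_of_le Δ Θ h).getElem _

/-- `v` is a factor of the infinite word `u`. -/
def IsFactor (u : ℕ → Bool) (v : Word) : Prop :=
  ∃ i : ℕ, v = (List.range v.length).map (fun j => u (i + j))

/-- `v` is a left special factor of `u`. -/
def IsLeftSpecial (u : ℕ → Bool) (v : Word) : Prop :=
  IsFactor u (false :: v) ∧ IsFactor u (true :: v)

/-- `v` is a right special factor of `u`. -/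
def IsRightSpecial (u : ℕ → Bool) (v : Word) : Prop :=
  IsFactor u (v ++ [false]) ∧ IsFactor u (v ++ [true])

/-- `v` is a bispecial factor of `u`. -/
def IsBispecial (u : ℕ → Bool) (v : Word) : Prop :=
  IsFactor u v ∧ IsLeftSpecial u v ∧ IsRightSpecial u v

/-- The set of pairs of letters `(a, b)` such that `avb` is a factor of `u`. -/
def bilateralExt (u : ℕ → Bool) (v : Word) : Set (Bool × Bool) :=
  {p | IsFactor u (p.1 :: (v ++ [p.2]))}

/-- `v` is a weak bispecial factor of `u`: it is bispecial and its only bilateral extensions are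
`0v1` and `1v0`, or its only bilateral extensions are `0v0` and `1v1`. -/
def IsWeakBispecial (u : ℕ → Bool) (v : Word) : Prop :=
  IsBispecial u v ∧
    (bilateralExt u v = {(false, true), (true, false)} ∨
      bilateralExt u v = {(false, false), (true, true)})

/-- The constant directive sequence `1^ω`. -/
def deltaP : ℕ → Bool := fun _ => true

/-- The directive sequence `(EERR)^ω` of antimorphisms. -/
def thetaP : ℕ → Anti := fun n => if n % 4 < 2 then Anti.E else Anti.R

/-- The prefixes `w_n` of `u_p`. -/
def wP (n : ℕ) : Word := pref deltaP thetaP n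

/-- The infinite word `u_p = u(1^ω, (EERR)^ω)`. -/
def uP : ℕ → Bool := word deltaP thetaP

/-- The word `v w⁻¹ z`, for a prefix `w` of `z`. -/
def cancelMul (v w z : Word) : Word := v ++ z.drop w.length

/-- `s_{4k+1} = R(w_{4(k-1)+1}) w_{4(k-1)}⁻¹ w_{4(k-1)+3} w_{4(k-1)}⁻¹ w_{4(k-1)+1}`, for `k ≥ 1`. -/
def sOne (k : ℕ) : Word :=
  cancelMul
    (cancelMul (Anti.R.app (wP (4 * (k - 1) + 1))) (wP (4 * (k - 1))) (wP (4 * (k - 1) + 3)))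
    (wP (4 * (k - 1))) (wP (4 * (k - 1) + 1))

/-- `s_{4k+3} = E(w_{4(k-1)+3}) w_{4k-2}⁻¹ w_{4k+1} w_{4k-2}⁻¹ w_{4(k-1)+3}`, for `k ≥ 1`. -/
def sThree (k : ℕ) : Word :=
  cancelMul
    (cancelMul (Anti.E.app (wP (4 * (k - 1) + 3))) (wP (4 * k - 2)) (wP (4 * k + 1)))
    (wP (4 * k - 2)) (wP (4 * (k - 1) + 3))

/-- `sP n` is `s_n`, for odd `n ≥ 5`. (Other `n` are not used.) -/
def sP (n : ℕ) : Word := if n % 4 = 1 then sOne (n / 4) else sThree (n / 4)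

end Pseudostandard

/-! Replace a word by the sequence of differences (`xor`) of consecutive letters. For `n ≥ 2` the
prefixes `w_n` have differences `τ(p) 111`, with `p = palPsi (n - 2)` a palindromic prefix of the
fixed point of `ψ : a ↦ abac, b ↦ aba, c ↦ abaa` and `τ : a ↦ 1, b ↦ 1110, c ↦ 111010` (`wP_eq`).
The factors of `u_p` are closed under exchange of letters, so a nonempty word is a factor exactly
when its differences are (`isFactor_uP_integ_iff`). Weakness is also visible on differences
(`isWeakBispecial_integ_iff`).

Both `ψ` and `τ` send letters to return words of a palindrome `G` (`aba`, resp. `111`). A factor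
containing `G` is thus uniquely `l M(x) G r`, and its extensions are read off from those of `x`
(`extension_iff`). Up to the partition of the letters into `{a}` and `{b, c}`, a weak word is either
`M(x) G` with `x` weak, or one exceptional word built on `x = a` (`IsColoredReturn.isWeakFor_iff`);
a finite check shows that every weak word contains `G`. Descent on length leaves a single sequence
of weak words, `weakPsi` for `ψ` and `weakDiff` for the differences.

The expression `R(A) B⁻¹ C B⁻¹ A` commutes with `x ↦ M(x) G`, so the words `s_{2k+1}` run through
this sequence (`sP_eq`). As `weakDiff n` is a palindrome, `R` and `E` applied to `s_{2k+1}` give the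
two words with these differences, one for each first letter.

Identifying `w_n` requires the closures. Palindromic prefixes desubstitute, hence are known, and
length identities show that no palindromic suffix is long enough to give a shorter closure
(`closure_palWord`). -/

namespace Pseudostandard

/-! ### Return morphisms and desubstitution -/

section ReturnMorphism

variable {α β : Type*}

/-- The words `M e`, for letters `e`, are return words to the palindrome `G`: each `M e ++ G` is a
palindrome in which `G` occurs as a prefix and as a suffix, and nowhere else. -/
structure IsReturnMorphism (M : α → List β) (G : List β) : Prop where
  pal : ∀ e, (M e ++ G).reverse = M e ++ G
  palG : G.reverse = G
  start : ∀ e, G <+: M e ++ G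
  ne_nil : ∀ e, M e ≠ []
  return_eq : ∀ e l, l ++ G <+: M e ++ G → l = [] ∨ l = M e
  inj : ∀ e f, M e ++ G <+: M f ++ G → e = f

/-- The word `M(x) G`. -/
def retWord (M : α → List β) (G : List β) (x : List α) : List β := x.flatMap M ++ G

variable {M : α → List β} {G : List β}

theorem retWord_cons (e : α) (x : List α) : retWord M G (e :: x) = M e ++ retWord M G x := by
  simp [retWord]

theorem retWord_append (x y : List α) :
    retWord M G (x ++ y) = x.flatMap M ++ retWord M G y := by
  simp [retWord]

namespace IsReturnMorphism

variable (hM : IsReturnMorphism M G)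
include hM

theorem prefix_retWord (x : List α) : G <+: retWord M G x := by
  induction x with
  | nil => simp [retWord]
  | cons e x ih =>
    rw [retWord_cons]
    obtain ⟨t, ht⟩ := ih
    rw [← ht, ← List.append_assoc]
    exact (hM.start e).trans (List.prefix_append _ _)

theorem infix_retWord {x y : List α} (h : x <:+: y) : retWord M G x <:+: retWord M G y := by
  obtain ⟨s, t, rfl⟩ := h
  obtain ⟨z, hz⟩ := hM.prefix_retWord t
  refine ⟨s.flatMap M, z, ?_⟩
  rw [retWord_append, ← hz]
  simp [retWord]

theorem prefix_retWord_cons (e : α) (x : List α) : M e ++ G <+: retWord M G (e :: x) := by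
  rw [retWord_cons]
  exact (List.prefix_append_right_inj _).2 (hM.prefix_retWord x)

/-- Palindromicity of `M e ++ G` means `G ++ (M e).reverse = M e ++ G`, so `G` slides through the
reversed blocks. -/
theorem reverse_retWord (x : List α) : (retWord M G x).reverse = retWord M G x.reverse := by
  induction x with
  | nil => simp [retWord, hM.palG]
  | cons e x ih =>
    have h1 : (retWord M G (e :: x)).reverse = (retWord M G x).reverse ++ (M e).reverse := by
      rw [retWord_cons, List.reverse_append]
    have h2 : G ++ (M e).reverse = M e ++ G := by
      have := hM.pal e
      rwa [List.reverse_append, hM.palG] at this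
    rw [h1, ih, List.reverse_cons, retWord_append, retWord, List.append_assoc, h2]
    simp [retWord]

/-- The occurrences of `G` in `M(y) G` are those at the ends of the words `M(y₁)`, for prefixes
`y₁` of `y`. -/
theorem exists_cut (y : List α) (l r : List β) (h : retWord M G y = l ++ (G ++ r)) :
    ∃ y₁ y₂, y = y₁ ++ y₂ ∧ l = y₁.flatMap M ∧ G ++ r = retWord M G y₂ := by
  induction y generalizing l with
  | nil =>
    have hl := congrArg List.length h
    simp only [retWord, List.flatMap_nil, List.nil_append, List.length_append] at hl
    have h1 : l = [] := List.length_eq_zero_iff.1 (by omega)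
    subst h1
    exact ⟨[], [], rfl, rfl, by simpa using h.symm⟩
  | cons e y ih =>
    by_cases hle : (M e).length ≤ l.length
    · have hp : M e <+: l :=
        List.prefix_of_prefix_length_le (l₃ := retWord M G (e :: y))
          (by rw [retWord_cons]; exact List.prefix_append _ _)
          (by rw [h]; exact List.prefix_append _ _) hle
      obtain ⟨l', rfl⟩ := hp
      rw [retWord_cons, List.append_assoc, List.append_cancel_left_eq] at h
      obtain ⟨y₁, y₂, rfl, rfl, h3⟩ := ih l' h
      exact ⟨e :: y₁, y₂, rfl, by simp, h3⟩
    -- This occurrence of `G` starts strictly inside the first block, so the return word property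
    -- puts it at the very beginning.
    · have hp : l ++ G <+: M e ++ G :=
        List.prefix_of_prefix_length_le (l₃ := retWord M G (e :: y))
          (by rw [h, ← List.append_assoc]; exact List.prefix_append _ _)
          (hM.prefix_retWord_cons e y) (by simp only [List.length_append]; omega)
      rcases hM.return_eq e l hp with rfl | rfl
      · exact ⟨[], e :: y, rfl, rfl, by simpa using h.symm⟩
      · omega

/-- By `inj`, the prefix `M e ++ G` determines the first letter. -/
theorem retWord_injective {x y : List α} (h : retWord M G x = retWord M G y) : x = y := by
  induction x generalizing y with
  | nil =>
    cases y with
    | nil => rfl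
    | cons f y =>
      have hl := congrArg List.length h
      have := List.length_pos_iff.2 (hM.ne_nil f)
      simp [retWord] at hl
      omega
  | cons e x ih =>
    cases y with
    | nil =>
      have hl := congrArg List.length h
      have := List.length_pos_iff.2 (hM.ne_nil e)
      simp [retWord] at hl
      omega
    | cons f y =>
      have h1 := hM.prefix_retWord_cons e x
      have h2 := hM.prefix_retWord_cons f y
      rw [h] at h1
      have hef : e = f := by
        rcases List.prefix_or_prefix_of_prefix h1 h2 with h3 | h3
        · exact hM.inj _ _ h3
        · exact (hM.inj _ _ h3).symm
      subst hef
      rw [retWord_cons, retWord_cons, List.append_cancel_left_eq] at h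
      rw [ih h]

theorem flatMap_injective {x y : List α} (h : x.flatMap M = y.flatMap M) : x = y :=
  hM.retWord_injective (by rw [retWord, h, retWord])

/-- A factor of `M(y) G` that does not contain `G` lies in some `M e ++ G`. -/
theorem infix_letter [Nonempty α] (y : List α) (v : List β) (h : v <:+: retWord M G y) :
    G <:+: v ∨ ∃ e, v <:+: M e ++ G := by
  induction y with
  | nil =>
    obtain ⟨e⟩ := ‹Nonempty α›
    exact Or.inr ⟨e, h.trans (by simpa [retWord] using (List.suffix_append (M e) G).isInfix)⟩
  | cons e y ih =>
    obtain ⟨A, B, hAB⟩ := h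
    by_cases hle : (M e).length ≤ A.length
    · have hp : M e <+: A :=
        List.prefix_of_prefix_length_le (l₃ := retWord M G (e :: y))
          (by rw [retWord_cons]; exact List.prefix_append _ _)
          (by rw [← hAB, List.append_assoc]; exact List.prefix_append _ _) hle
      obtain ⟨A', rfl⟩ := hp
      rw [retWord_cons, List.append_assoc, List.append_assoc, List.append_cancel_left_eq] at hAB
      exact ih ⟨A', B, by rw [← hAB, List.append_assoc]⟩
    · have h1 : A ++ v <+: retWord M G (e :: y) := ⟨B, hAB⟩
      rcases List.prefix_or_prefix_of_prefix h1 (hM.prefix_retWord_cons e y) with h2 | h2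
      · exact Or.inr ⟨e, (List.suffix_append A v).isInfix.trans h2.isInfix⟩
      -- Here `v` starts inside `M e` and reaches beyond `M e ++ G`, so it covers that copy of `G`.
      · left
        have h3 : A <+: M e :=
          List.prefix_of_prefix_length_le ((List.prefix_append A v).trans h1)
            ((List.prefix_append _ G).trans (hM.prefix_retWord_cons e y)) (by omega)
        obtain ⟨s, hs⟩ := h3
        rw [← hs, List.append_assoc] at h2
        have h4 := (List.prefix_append_right_inj A).1 h2
        exact (List.suffix_append s G).isInfix.trans h4.isInfix

end IsReturnMorphism

/-- In the word `l ++ G`, the word `G` occurs only as a suffix. -/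
def OnlySuffix (G l : List β) : Prop := ∀ l₁ l₂, l = l₁ ++ l₂ → G <+: l₂ ++ G → l₂ = []

theorem exists_first_occurrence (G v : List β) (h : G <:+: v) :
    ∃ l s, v = l ++ (G ++ s) ∧ OnlySuffix G l := by
  classical
  have hex : ∃ n, ∃ l s, v = l ++ (G ++ s) ∧ l.length = n := by
    obtain ⟨l, s, hs⟩ := h
    exact ⟨l.length, l, s, by rw [← hs, List.append_assoc], rfl⟩
  obtain ⟨l, s, hv, hl⟩ := Nat.find_spec hex
  refine ⟨l, s, hv, ?_⟩
  rintro l₁ l₂ rfl ⟨t, ht⟩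
  have := Nat.find_min' hex ⟨l₁, t ++ s, by
    rw [hv, ← List.append_assoc G t s, ht]; simp, rfl⟩
  rw [← hl, List.length_append] at this
  exact List.length_eq_zero_iff.1 (by omega)

theorem exists_last_occurrence (hG : G.reverse = G) (v : List β) (h : G <:+: v) :
    ∃ l r, v = l ++ (G ++ r) ∧ OnlySuffix G r.reverse := by
  obtain ⟨l, s, hv, hl⟩ := exists_first_occurrence G v.reverse (by
    rw [← List.reverse_infix, List.reverse_reverse, hG]; exact h)
  refine ⟨s.reverse, l.reverse, ?_, by rwa [List.reverse_reverse]⟩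
  rw [← List.reverse_reverse v, hv]
  simp [hG]

/-- The language of the factors of the words `f n`. -/
def Lang (f : ℕ → List β) (v : List β) : Prop := ∃ n, v <:+: f n

theorem Lang.mono {f : ℕ → List β} {v w : List β} (hw : Lang f w) (h : v <:+: w) : Lang f v := by
  obtain ⟨n, hn⟩ := hw
  exact ⟨n, h.trans hn⟩

/-- The language of the words `M(x) G`, for `x` in the language of `f`. -/
abbrev RetLang (M : α → List β) (G : List β) (f : ℕ → List α) : List β → Prop :=
  Lang fun n => retWord M G (f n)

namespace IsReturnMorphism

variable (hM : IsReturnMorphism M G)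
include hM

/-- A factor that contains `G` is of the form `l M(x) G r`. -/
theorem exists_decomposition {f : ℕ → List α} {v : List β} (hv : RetLang M G f v)
    (hG : G <:+: v) :
    ∃ l x r, v = l ++ (retWord M G x ++ r) ∧ OnlySuffix G l ∧ OnlySuffix G r.reverse := by
  obtain ⟨n, A, B, hAB⟩ := hv
  dsimp only at hAB
  obtain ⟨l, s, rfl, hl⟩ := exists_first_occurrence G v hG
  obtain ⟨k, r, hk, hr⟩ := exists_last_occurrence hM.palG (G ++ s)
    (List.prefix_append G s).isInfix
  obtain ⟨y₁, y₂, -, -, h3⟩ := hM.exists_cut (f n) (A ++ l) (s ++ B) (by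
    rw [← hAB]; simp)
  obtain ⟨y₃, y₄, -, h5, -⟩ := hM.exists_cut y₂ k (r ++ B) (by
    rw [← h3, ← List.append_assoc, hk]; simp)
  exact ⟨l, y₃, r, by rw [hk, h5]; simp [retWord], hl, hr⟩

/-- The bilateral extensions of `l M(x) G r` are read off from those of `x`. -/
theorem extension_iff {f : ℕ → List α} {l r : List β} (hl : OnlySuffix G l)
    (hr : OnlySuffix G r.reverse) (x : List α) (p q : β) :
    RetLang M G f (p :: ((l ++ (retWord M G x ++ r)) ++ [q])) ↔
      ∃ e g, Lang f (e :: (x ++ [g])) ∧ p :: l <:+ M e ∧ q :: r.reverse <:+ M g := by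
  constructor
  · rintro ⟨n, A, B, hAB⟩
    dsimp only at hAB
    obtain ⟨t, ht⟩ := hM.prefix_retWord x
    obtain ⟨y₁, y₂, hy, h1, h2⟩ := hM.exists_cut (f n) (A ++ p :: l) (t ++ (r ++ q :: B)) (by
      rw [← hAB, ← List.append_assoc G t, ht]; simp)
    rw [← List.append_assoc G t, ht] at h2
    obtain ⟨y₃, y₄, hy', h3, h4⟩ := hM.exists_cut y₂ (x.flatMap M) (r ++ q :: B) (by
      rw [← h2]; simp [retWord])
    obtain rfl := hM.flatMap_injective h3
    subst hy'
    rcases List.eq_nil_or_concat y₁ with rfl | ⟨y₁, e, rfl⟩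
    · simp at h1
    rcases y₄ with _ | ⟨g, y₄⟩
    · have := congrArg List.length h4
      simp [retWord] at this
    refine ⟨e, g, ⟨n, y₁, y₄, by rw [hy]; simp⟩, ?_, ?_⟩
    -- Two suffixes of one word are comparable. Were `M e` a suffix of `l`, then `G`, a prefix of `M
    -- e ++ G`, would occur too early in `l ++ G`.
    · have hs : p :: l <:+ A ++ p :: l := List.suffix_append _ _
      have hs' : M e <:+ A ++ p :: l := by
        rw [h1]
        simp
      rcases List.suffix_or_suffix_of_suffix hs hs' with h | h
      · exact h
      · rcases List.suffix_cons_iff.1 h with h | ⟨l₁, h⟩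
        · rw [h]
        · exfalso
          exact hM.ne_nil e (hl l₁ _ h.symm (hM.start e))
    -- The right end is the mirror image of the left one, because `M g ++ G` is a palindrome.
    · have hp : G ++ (r ++ [q]) <+: retWord M G (g :: y₄) := by
        rw [← h4]
        exact ⟨B, by simp⟩
      rcases List.prefix_or_prefix_of_prefix hp (hM.prefix_retWord_cons g y₄) with h | h
      · have h' := List.reverse_suffix.2 h
        rw [hM.pal] at h'
        have h'' : (G ++ (r ++ [q])).reverse = (q :: r.reverse) ++ G := by simp [hM.palG]
        rw [h''] at h'
        obtain ⟨B', hB'⟩ := h'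
        rw [← List.append_assoc, List.append_cancel_right_eq] at hB'
        exact ⟨B', hB'⟩
      · rcases h with ⟨B', hB⟩
        rcases List.eq_nil_or_concat B' with rfl | ⟨B', z, rfl⟩
        · have h' := congrArg List.reverse hB
          rw [List.append_nil, hM.pal] at h'
          have h'' : (G ++ (r ++ [q])).reverse = (q :: r.reverse) ++ G := by simp [hM.palG]
          rw [h'', List.append_cancel_right_eq] at h'
          rw [h']
        · exfalso
          have h5 : M g ++ G ++ B' = G ++ r := by
            have : (M g ++ G ++ B') ++ [z] = (G ++ r) ++ [q] := by simpa using hB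
            exact (List.append_inj' this rfl).1
          have h6 := congrArg List.reverse h5
          rw [List.reverse_append, hM.pal, List.reverse_append, hM.palG, ← List.append_assoc,
            List.append_cancel_right_eq] at h6
          exact hM.ne_nil g (hr _ _ h6.symm (hM.start g))
  · rintro ⟨e, g, ⟨n, hn⟩, ⟨A, hA⟩, ⟨B, hB⟩⟩
    refine ⟨n, (List.IsInfix.trans ?_ (hM.infix_retWord hn))⟩
    have h1 : M g ++ G = G ++ (r ++ [q] ++ B.reverse) := by
      rw [← hM.pal g, ← hB]
      simp [hM.palG]
    refine ⟨A, B.reverse, ?_⟩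
    have h2 : retWord M G (e :: (x ++ [g])) = M e ++ (x.flatMap M ++ (M g ++ G)) := by
      simp [retWord]
    rw [h2, ← hA, h1]
    simp [retWord]

end IsReturnMorphism

end ReturnMorphism

/-! ### The substitution, the coding and the language of the fixed point -/

/-- The morphism `a ↦ abac`, `b ↦ aba`, `c ↦ abaa` (the letters are `a = 0`, `b = 1`, `c = 2`). -/
def morPsi : Fin 3 → List (Fin 3) := ![[0, 1, 0, 2], [0, 1, 0], [0, 1, 0, 0]]

/-- The coding `a ↦ 1`, `b ↦ 1110`, `c ↦ 111010`. -/
def morTau : Fin 3 → List Bool :=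
  ![[true], [true, true, true, false], [true, true, true, false, true, false]]

/-- A word `l` with `l ++ G` a prefix of `M e ++ G` is a prefix of `M e`; this bounds the search and
makes `return_eq` decidable. -/
theorem isReturnMorphism_of_take {α β : Type*} {M : α → List β} {G : List β}
    (pal : ∀ e, (M e ++ G).reverse = M e ++ G) (palG : G.reverse = G)
    (start : ∀ e, G <+: M e ++ G) (ne_nil : ∀ e, M e ≠ [])
    (return_eq : ∀ e, ∀ k < (M e).length + 1, (M e).take k ++ G <+: M e ++ G →
      (M e).take k = [] ∨ (M e).take k = M e)
    (inj : ∀ e f, M e ++ G <+: M f ++ G → e = f) : IsReturnMorphism M G where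
  pal := pal
  palG := palG
  start := start
  ne_nil := ne_nil
  return_eq := fun e l h => by
    have hl : l.length ≤ (M e).length := by simpa using h.length_le
    have hp : l <+: M e := List.prefix_of_prefix_length_le ((List.prefix_append l G).trans h)
      (List.prefix_append _ _) hl
    have hk := return_eq e l.length (by omega)
    rw [← List.prefix_iff_eq_take.1 hp] at hk
    exact hk h
  inj := inj

theorem isReturnMorphism_morPsi : IsReturnMorphism morPsi [0, 1, 0] :=
  isReturnMorphism_of_take (by decide) (by decide) (by decide) (by decide) (by decide) (by decide)

theorem isReturnMorphism_morTau : IsReturnMorphism morTau [true, true, true] :=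
  isReturnMorphism_of_take (by decide) (by decide) (by decide) (by decide) (by decide) (by decide)

/-- The palindromic prefixes of the fixed point of `morPsi`. -/
def palPsi : ℕ → List (Fin 3)
  | 0 => []
  | 1 => [0]
  | n + 2 => retWord morPsi [0, 1, 0] (palPsi n)

/-- The letter that follows `palPsi n` in the fixed point of `morPsi`. -/
def nextPsi : ℕ → Fin 3
  | 0 => 0
  | 1 => 1
  | n + 2 => ![2, 0, 0] (nextPsi n)

/-- If `e` follows `x`, then `ψ(x) aba` is followed by the fourth letter of `ψ(e) aba`, which is
`c`, `a`, `a` for `e = a`, `b`, `c`. -/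
theorem palPsi_next_prefix (n : ℕ) : palPsi n ++ [nextPsi n] <+: palPsi (n + 1) := by
  induction n using Nat.twoStepInduction with
  | zero => decide
  | one => decide
  | more n ih _ =>
    obtain ⟨t, ht⟩ := ih
    have key : ∀ e : Fin 3, [0, 1, 0] ++ [![2, 0, 0] e] <+: morPsi e ++ [0, 1, 0] := by decide
    have h1 : palPsi (n + 3) = (palPsi n).flatMap morPsi ++
        retWord morPsi [0, 1, 0] (nextPsi n :: t) := by
      rw [palPsi, ← ht, List.append_assoc, retWord_append]
      rfl
    rw [h1, palPsi, nextPsi, retWord, List.append_assoc, List.prefix_append_right_inj]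
    exact (key _).trans (isReturnMorphism_morPsi.prefix_retWord_cons _ _)

theorem palPsi_prefix_of_le {m n : ℕ} (h : m ≤ n) : palPsi m <+: palPsi n := by
  induction n, h using Nat.le_induction with
  | base => exact List.prefix_rfl
  | succ n _ ih => exact ih.trans ((List.prefix_append _ _).trans (palPsi_next_prefix n))

theorem reverse_palPsi (n : ℕ) : (palPsi n).reverse = palPsi n := by
  induction n using Nat.twoStepInduction with
  | zero => rfl
  | one => rfl
  | more n ih _ => rw [palPsi, isReturnMorphism_morPsi.reverse_retWord, ih]

theorem langPsi_iff (v : List (Fin 3)) :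
    RetLang morPsi [0, 1, 0] palPsi v ↔ Lang palPsi v := by
  constructor
  · rintro ⟨n, hn⟩
    exact ⟨n + 2, hn⟩
  · rintro ⟨n, hn⟩
    exact ⟨n, hn.trans (palPsi_prefix_of_le (Nat.le_add_right n 2)).isInfix⟩

theorem infix_letter_of_langPsi {v : List (Fin 3)} (hv : Lang palPsi v) :
    [0, 1, 0] <:+: v ∨ ∃ e, v <:+: morPsi e ++ [0, 1, 0] := by
  obtain ⟨n, hn⟩ := (langPsi_iff v).2 hv
  exact isReturnMorphism_morPsi.infix_letter _ _ hn

/-- The letter `a`, as opposed to `b` and `c`. -/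
def isA (e : Fin 3) : Bool := e == 0

/-- A factor without `aba` lies in some `ψ(e) aba`, which leaves finitely many cases; the same
argument excludes `bab` and `cac` below. -/
theorem langPsi_pair {e f : Fin 3} (h : Lang palPsi [e, f]) : e = 0 ∨ f = 0 := by
  have h1 := infix_letter_of_langPsi h
  clear h
  revert e f
  decide

theorem langPsi_triple {e f : Fin 3} (h : Lang palPsi [e, 0, f]) (he : e ≠ 0) (hf : f ≠ 0) :
    e ≠ f := by
  have h1 := infix_letter_of_langPsi h
  clear h
  revert e f
  decide

theorem langPsi_bc : Lang palPsi [1, 0, 2] := ⟨5, by decide⟩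

theorem langPsi_cb : Lang palPsi [2, 0, 1] := ⟨5, by decide⟩

theorem langPsi_ba : Lang palPsi [1, 0, 0] := ⟨5, by decide⟩

/-- A property of the factors of the words `M e ++ G` that do not contain `G` can be checked on
finitely many words. -/
theorem forall_letter_infix {α β : Type*} {M : α → List β} {G : List β} {P : List β → Prop}
    (h : ∀ e, ∀ t ∈ (M e ++ G).tails, ∀ x ∈ t.inits, P x) {x : List β}
    (hx : ∃ e, x <:+: M e ++ G) : P x := by
  obtain ⟨e, he⟩ := hx
  obtain ⟨t, h1, h2⟩ := List.infix_iff_prefix_suffix.1 he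
  exact h e t ((List.mem_tails _ _).2 h2) x ((List.mem_inits _ _).2 h1)

/-- The only words that the letters `b` and `c` both extend to the left are `ε` and `a`. -/
theorem eq_of_extension_b_c {x : List (Fin 3)} {f g : Fin 3}
    (hb : Lang palPsi (1 :: (x ++ [f]))) (hc : Lang palPsi (2 :: (x ++ [g]))) : x = [] ∨ x = [0] := by
  have hb' : Lang palPsi (1 :: x) := hb.mono ⟨[], [f], by simp⟩
  have hc' : Lang palPsi (2 :: x) := hc.mono ⟨[], [g], by simp⟩
  by_cases hG : [0, 1, 0] <:+: x
  · exfalso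
    have hx : RetLang morPsi [0, 1, 0] palPsi x :=
      (langPsi_iff x).2 (hb'.mono (List.suffix_cons 1 x).isInfix)
    obtain ⟨l, x, r, rfl, hl, hr⟩ := isReturnMorphism_morPsi.exists_decomposition hx hG
    obtain ⟨e, -, -, h1, -⟩ := (isReturnMorphism_morPsi.extension_iff hl hr x 1 f).1
      ((langPsi_iff _).2 hb)
    obtain ⟨e', -, -, h2, -⟩ := (isReturnMorphism_morPsi.extension_iff hl hr x 2 g).1
      ((langPsi_iff _).2 hc)
    -- No word is preceded by `b` in a suffix of one image and by `c` in a suffix of another.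
    have key : ∀ e e', ∀ t ∈ (morPsi e).tails, ∀ t' ∈ (morPsi e').tails,
        ¬ (t.head? = some 1 ∧ t'.head? = some 2 ∧ t.tail = t'.tail) := by decide
    exact key e e' _ ((List.mem_tails _ _).2 h1) _ ((List.mem_tails _ _).2 h2) (by simp)
  · refine forall_letter_infix (P := fun x => ¬ [0, 1, 0] <:+: x →
      ([0, 1, 0] <:+: 1 :: x ∨ ∃ e, 1 :: x <:+: morPsi e ++ [0, 1, 0]) →
      ([0, 1, 0] <:+: 2 :: x ∨ ∃ e, 2 :: x <:+: morPsi e ++ [0, 1, 0]) →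
      x = [] ∨ x = [0]) (by decide)
      ((infix_letter_of_langPsi (hb'.mono (List.suffix_cons 1 x).isInfix)).resolve_left hG)
      hG (infix_letter_of_langPsi hb') (infix_letter_of_langPsi hc')

/-! ### Weak words for a two-colouring of the letters -/

/-- The letters `p`, `q` such that `pvq` is in the language `K` have, in terms of the two classes
of letters given by `h`, either always the same class or always different classes, and all
combinations of this kind occur. -/
def IsWeakFor {β : Type*} (K : List β → Prop) (h : β → Bool) (v : List β) : Prop :=
  ∃ c, ∀ i j, (∃ p q, h p = i ∧ h q = j ∧ K (p :: (v ++ [q]))) ↔ xor i j = c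

namespace IsWeakFor

variable {β : Type*} {K : List β → Prop} {h : β → Bool} {v : List β}

theorem exists_left (H : IsWeakFor K h v) (i : Bool) :
    ∃ p q, h p = i ∧ K (p :: (v ++ [q])) := by
  obtain ⟨c, hc⟩ := H
  obtain ⟨p, q, h1, -, h3⟩ := (hc i (xor i c)).2 (by simp)
  exact ⟨p, q, h1, h3⟩

theorem exists_right (H : IsWeakFor K h v) (j : Bool) :
    ∃ p q, h q = j ∧ K (p :: (v ++ [q])) := by
  obtain ⟨c, hc⟩ := H
  obtain ⟨p, q, -, h1, h3⟩ := (hc (xor c j) j).2 (by simp)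
  exact ⟨p, q, h1, h3⟩

/-- Used to refute weakness: one left class occurring with both right classes is enough. -/
theorem eq_of_left (H : IsWeakFor K h v) {p q p' q' : β} (h1 : K (p :: (v ++ [q])))
    (h2 : K (p' :: (v ++ [q']))) (hp : h p = h p') : h q = h q' := by
  obtain ⟨c, hc⟩ := H
  have h3 := (hc _ _).1 ⟨p, q, rfl, rfl, h1⟩
  have h4 := (hc _ _).1 ⟨p', q', rfl, rfl, h2⟩
  rw [← h4, hp] at h3
  simpa using h3

theorem reverse (hK : ∀ w, K w → K w.reverse) (H : IsWeakFor K h v) :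
    IsWeakFor K h v.reverse := by
  obtain ⟨c, hc⟩ := H
  refine ⟨c, fun i j => ?_⟩
  rw [Bool.xor_comm, ← hc j i]
  constructor
  · rintro ⟨p, q, h1, h2, h3⟩
    exact ⟨q, p, h2, h1, by simpa using hK _ h3⟩
  · rintro ⟨p, q, h1, h2, h3⟩
    exact ⟨q, p, h2, h1, by simpa using hK _ h3⟩

end IsWeakFor

/-- A return morphism whose words `M a`, `M b`, `M c`, as sets of suffixes preceded by a letter of
class `h`, behave as follows: the class of the last letter separates `a` from `b` and `c`, and the
class of the letter before the suffix `l₀` separates `b` from `c`; no other suffix is preceded by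
letters of both classes. -/
structure IsColoredReturn {β : Type*} (M : Fin 3 → List β) (G : List β) (h : β → Bool)
    (l₀ : List β) (s s' : Bool) : Prop where
  ret : IsReturnMorphism M G
  last : ∀ e p, [p] <:+ M e → h p = xor s (isA e)
  dich : ∀ e e' p p' l, p :: l <:+ M e → p' :: l <:+ M e' → h p ≠ h p' → l = [] ∨ l = l₀
  inner : ∀ e p, p :: l₀ <:+ M e → (e = 1 ∧ h p = s') ∨ (e = 2 ∧ h p = !s')
  inner_b : ∃ p, p :: l₀ <:+ M 1
  inner_c : ∃ p, p :: l₀ <:+ M 2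
  only : OnlySuffix G l₀

theorem onlySuffix_nil {β : Type*} (G : List β) : OnlySuffix G [] := by
  intro l₁ l₂ h _
  exact (List.append_eq_nil_iff.1 h.symm).2

namespace IsColoredReturn

variable {β : Type*} {M : Fin 3 → List β} {G : List β} {h : β → Bool} {l₀ : List β} {s s' : Bool}
  (hM : IsColoredReturn M G h l₀ s s')
include hM

theorem exists_last (e : Fin 3) : ∃ p, [p] <:+ M e := by
  rcases List.eq_nil_or_concat (M e) with h1 | ⟨l, p, h1⟩
  · exact absurd h1 (hM.ret.ne_nil e)
  · exact ⟨p, by rw [h1]; simp⟩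

theorem reverse_mem {v : List β} (hv : RetLang M G palPsi v) : RetLang M G palPsi v.reverse := by
  obtain ⟨n, hn⟩ := hv
  have h1 := List.reverse_infix.2 hn
  rw [hM.ret.reverse_retWord, reverse_palPsi] at h1
  exact ⟨n, h1⟩

/-- The letters around `M(x) G` are the last letters of the neighbouring blocks, up to reversal.
Their classes are those of the neighbours of `x` shifted by `s`, and the shift cancels in `xor i j`.
-/
theorem isWeakFor_retWord_iff (x : List (Fin 3)) :
    IsWeakFor (RetLang M G palPsi) h (retWord M G x) ↔ IsWeakFor (Lang palPsi) isA x := by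
  have key : ∀ i j, (∃ p q, h p = xor s i ∧ h q = xor s j ∧
      RetLang M G palPsi (p :: (retWord M G x ++ [q]))) ↔
      ∃ e f, isA e = i ∧ isA f = j ∧ Lang palPsi (e :: (x ++ [f])) := by
    intro i j
    have h0 := fun p q => hM.ret.extension_iff (f := palPsi) (onlySuffix_nil G)
      (r := []) (onlySuffix_nil G) x p q
    simp only [List.nil_append, List.append_nil, List.reverse_nil] at h0
    constructor
    · rintro ⟨p, q, h1, h2, h3⟩
      obtain ⟨e, f, h4, h5, h6⟩ := (h0 p q).1 h3
      rw [hM.last e p h5] at h1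
      rw [hM.last f q h6] at h2
      exact ⟨e, f, by simpa using h1, by simpa using h2, h4⟩
    · rintro ⟨e, f, rfl, rfl, h4⟩
      obtain ⟨p, hp⟩ := hM.exists_last e
      obtain ⟨q, hq⟩ := hM.exists_last f
      exact ⟨p, q, hM.last e p hp, hM.last f q hq, (h0 p q).2 ⟨e, f, h4, hp, hq⟩⟩
  constructor
  · rintro ⟨c, hc⟩
    refine ⟨c, fun i j => ?_⟩
    rw [← key, hc]
    cases s <;> cases i <;> cases j <;> simp
  · rintro ⟨c, hc⟩
    refine ⟨c, fun i j => ?_⟩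
    have h1 := key (xor s i) (xor s j)
    rw [hc, ← Bool.xor_assoc, ← Bool.xor_assoc, Bool.xor_self, Bool.false_xor,
      Bool.false_xor] at h1
    rw [h1]
    cases s <;> cases i <;> cases j <;> simp

/-- The weak word `l₀ M(a) G r₀`, where `r₀` is the reversal of `l₀`. -/
theorem isWeakFor_exceptional :
    IsWeakFor (RetLang M G palPsi) h (l₀ ++ (retWord M G [0] ++ l₀.reverse)) := by
  have h0 := hM.ret.extension_iff (f := palPsi) hM.only
    (r := l₀.reverse) (by rw [List.reverse_reverse]; exact hM.only) [0]
  rw [List.reverse_reverse] at h0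
  refine ⟨true, fun i j => ?_⟩
  constructor
  · rintro ⟨p, q, rfl, rfl, h3⟩
    obtain ⟨e, f, h4, h5, h6⟩ := (h0 p q).1 h3
    -- Only `b` and `c` can surround `a` here. Since `bab` and `cac` are not factors, the two
    -- classes differ; `bac` and `cab` realise both cases.
    rcases hM.inner e p h5 with ⟨rfl, h7⟩ | ⟨rfl, h7⟩ <;>
      rcases hM.inner f q h6 with ⟨rfl, h8⟩ | ⟨rfl, h8⟩
    · exact absurd rfl (langPsi_triple h4 (by decide) (by decide))
    · rw [h7, h8]; simp
    · rw [h7, h8]; simp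
    · exact absurd rfl (langPsi_triple h4 (by decide) (by decide))
  · intro hij
    obtain ⟨p, hp⟩ := hM.inner_b
    obtain ⟨q, hq⟩ := hM.inner_c
    have h1 : h p = s' := by
      rcases hM.inner _ _ hp with ⟨-, h7⟩ | ⟨h7, -⟩
      · exact h7
      · exact absurd h7 (by decide)
    have h2 : h q = !s' := by
      rcases hM.inner _ _ hq with ⟨h7, -⟩ | ⟨-, h7⟩
      · exact absurd h7 (by decide)
      · exact h7
    by_cases hi : i = s'
    · exact ⟨p, q, by rw [h1, hi], by rw [h2, ← hi]; revert hij; cases i <;> cases j <;> simp,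
        (h0 p q).2 ⟨1, 2, langPsi_bc, hp, hq⟩⟩
    · exact ⟨q, p, by rw [h2]; revert hi; cases i <;> cases s' <;> simp,
        by rw [h1]; revert hi hij; cases i <;> cases j <;> cases s' <;> simp,
        (h0 q p).2 ⟨2, 1, langPsi_cb, hq, hp⟩⟩

/-- Both classes occur before `l₀`, so both `b` and `c` extend `x` to the left, whence `x` is `ε` or
`a`. If `x = ε`, the right neighbour is always `a`, which admits a single right class or none. If `x
= a` and `r` is empty, the factors `baa` and `bac` give one left class with both right classes. -/
theorem eq_exceptional_of_isWeakFor {x : List (Fin 3)} {r : List β}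
    (hr : OnlySuffix G r.reverse)
    (H : IsWeakFor (RetLang M G palPsi) h (l₀ ++ (retWord M G x ++ r)))
    (hr' : r.reverse = [] ∨ r.reverse = l₀) : x = [0] ∧ r.reverse = l₀ := by
  have h0 := hM.ret.extension_iff (f := palPsi) hM.only hr x
  obtain ⟨p, q, hp, h1⟩ := H.exists_left s'
  obtain ⟨p', q', hp', h1'⟩ := H.exists_left (!s')
  obtain ⟨e, f, h2, h3, h4⟩ := (h0 _ _).1 h1
  obtain ⟨e', f', h2', h3', h4'⟩ := (h0 _ _).1 h1'
  obtain rfl : e = 1 := by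
    rcases hM.inner e p h3 with ⟨h5, -⟩ | ⟨-, h5⟩
    · exact h5
    · rw [hp] at h5
      simp at h5
  obtain rfl : e' = 2 := by
    rcases hM.inner e' p' h3' with ⟨-, h5⟩ | ⟨h5, -⟩
    · rw [hp'] at h5
      simp at h5
    · exact h5
  rcases eq_of_extension_b_c h2 h2' with rfl | rfl
  · exfalso
    have h6 : ∀ p q, RetLang M G palPsi (p :: ((l₀ ++ (retWord M G [] ++ r)) ++ [q])) →
        q :: r.reverse <:+ M 0 := by
      intro p q hpq
      obtain ⟨e, f, h7, h8, h9⟩ := (h0 _ _).1 hpq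
      rcases langPsi_pair h7 with rfl | rfl
      · rcases hM.inner 0 p h8 with ⟨h5, -⟩ | ⟨h5, -⟩ <;> exact absurd h5 (by decide)
      · exact h9
    rcases hr' with hr' | hr'
    · obtain ⟨p, q, hq, h7⟩ := H.exists_right true
      obtain ⟨p', q', hq', h7'⟩ := H.exists_right false
      have h8 := h6 _ _ h7
      have h8' := h6 _ _ h7'
      rw [hr'] at h8 h8'
      have h9 := hM.last _ _ h8
      rw [← hM.last _ _ h8', hq, hq'] at h9
      simp at h9
    · have h8 := h6 _ _ h1
      rw [hr'] at h8
      rcases hM.inner 0 q h8 with ⟨h5, -⟩ | ⟨h5, -⟩ <;> exact absurd h5 (by decide)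
  · refine ⟨rfl, hr'.resolve_left fun hr' => ?_⟩
    rw [hr'] at h0
    obtain ⟨q₁, hq₁⟩ := hM.exists_last 0
    obtain ⟨q₂, hq₂⟩ := hM.exists_last 2
    have h5 := H.eq_of_left ((h0 p q₁).2 ⟨1, 0, langPsi_ba, h3, hq₁⟩)
      ((h0 p q₂).2 ⟨1, 2, langPsi_bc, h3, hq₂⟩) rfl
    rw [hM.last _ _ hq₁, hM.last _ _ hq₂] at h5
    revert h5
    cases s <;> decide

/-- The weak words that contain `G`. -/
theorem isWeakFor_iff {v : List β} (hG : G <:+: v) :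
    IsWeakFor (RetLang M G palPsi) h v ↔
      (∃ x, v = retWord M G x ∧ IsWeakFor (Lang palPsi) isA x) ∨
        v = l₀ ++ (retWord M G [0] ++ l₀.reverse) := by
  constructor
  · intro H
    obtain ⟨p, q, hp, h1⟩ := H.exists_left true
    obtain ⟨l, x, r, rfl, hl, hr⟩ := hM.ret.exists_decomposition
      (h1.mono ⟨[p], [q], by simp⟩) hG
    have h0 := hM.ret.extension_iff (f := palPsi) hl hr x
    have hl' : l = [] ∨ l = l₀ := by
      obtain ⟨p', q', hp', h1'⟩ := H.exists_left false
      obtain ⟨e, f, -, h3, -⟩ := (h0 _ _).1 h1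
      obtain ⟨e', f', -, h3', -⟩ := (h0 _ _).1 h1'
      exact hM.dich e e' p p' l h3 h3' (by rw [hp, hp']; simp)
    have hr' : r.reverse = [] ∨ r.reverse = l₀ := by
      obtain ⟨p, q, hq, h1⟩ := H.exists_right true
      obtain ⟨p', q', hq', h1'⟩ := H.exists_right false
      obtain ⟨e, f, -, -, h3⟩ := (h0 _ _).1 h1
      obtain ⟨e', f', -, -, h3'⟩ := (h0 _ _).1 h1'
      exact hM.dich f f' q q' _ h3 h3' (by rw [hq, hq']; simp)
    rcases hl' with rfl | rfl
    · rcases hr' with hr' | hr'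
      · rw [List.reverse_eq_nil_iff] at hr'
        subst hr'
        simp only [List.nil_append, List.append_nil] at H ⊢
        exact Or.inl ⟨x, rfl, (hM.isWeakFor_retWord_iff x).1 H⟩
      -- Reversal exchanges the two ends. The lemma then yields `[] = l₀`, and in that degenerate
      -- case the word is the exceptional one.
      · right
        have H' := H.reverse (fun w hw => hM.reverse_mem hw)
        have h2 : ([] ++ (retWord M G x ++ r)).reverse =
            l₀ ++ (retWord M G x.reverse ++ []) := by
          simp [hM.ret.reverse_retWord, hr']
        rw [h2] at H'
        obtain ⟨h3, h4⟩ := hM.eq_exceptional_of_isWeakFor (r := []) (onlySuffix_nil G) H' (Or.inl rfl)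
        rw [List.reverse_eq_iff] at h3
        rw [List.reverse_nil] at h4
        rw [h3, ← h4, ← List.reverse_reverse r, hr', ← h4]
        rfl
    · right
      obtain ⟨rfl, h4⟩ := hM.eq_exceptional_of_isWeakFor hr H hr'
      rw [← h4, List.reverse_reverse]
  · rintro (⟨x, rfl, hx⟩ | rfl)
    · exact (hM.isWeakFor_retWord_iff x).2 hx
    · exact hM.isWeakFor_exceptional

end IsColoredReturn

theorem isColoredReturn_of_tails {β : Type*} {M : Fin 3 → List β} {G : List β} {h : β → Bool}
    {l₀ : List β} {s s' : Bool} (ret : IsReturnMorphism M G)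
    (last : ∀ e p, [p] <:+ M e → h p = xor s (isA e))
    (dich : ∀ e e', ∀ t ∈ (M e).tails, ∀ t' ∈ (M e').tails, t.tail = t'.tail →
      t.head?.map h ≠ t'.head?.map h → t.tail = [] ∨ t.tail = l₀)
    (inner : ∀ e p, p :: l₀ <:+ M e → (e = 1 ∧ h p = s') ∨ (e = 2 ∧ h p = !s'))
    (inner_b : ∃ p, p :: l₀ <:+ M 1) (inner_c : ∃ p, p :: l₀ <:+ M 2)
    (only : ∀ t ∈ l₀.tails, G <+: t ++ G → t = []) :
    IsColoredReturn M G h l₀ s s' where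
  ret := ret
  last := last
  dich := fun e e' p p' l h1 h2 h3 => dich e e' _ ((List.mem_tails _ _).2 h1) _
    ((List.mem_tails _ _).2 h2) rfl (by simpa using h3)
  inner := inner
  inner_b := inner_b
  inner_c := inner_c
  only := fun l₁ l₂ h1 h2 => only l₂ ((List.mem_tails _ _).2 ⟨l₁, h1.symm⟩) h2

/-- The images end in `c`, `a`, `a`, which flips membership in `{a}`; before the final `a` stands
`b` in `ψ(b)` and `a` in `ψ(c)`. -/
theorem isColoredReturn_morPsi : IsColoredReturn morPsi [0, 1, 0] isA [0] true false :=
  isColoredReturn_of_tails isReturnMorphism_morPsi (by decide) (by decide) (by decide) (by decide)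
    (by decide) (by decide)

/-- The images end in `1`, `0`, `0`; before the final `10` stands `1` in `τ(b)` and `0` in `τ(c)`.
-/
theorem isColoredReturn_morTau :
    IsColoredReturn morTau [true, true, true] id [true, false] false true :=
  isColoredReturn_of_tails isReturnMorphism_morTau (by decide) (by decide) (by decide) (by decide)
    (by decide) (by decide)

/-- A necessary condition for a word to be a factor of the words `M(x) G`. -/
def LetterCompatible {β : Type*} (M : Fin 3 → List β) (G v : List β) : Prop :=
  G <:+: v ∨ ∃ e, v <:+: M e ++ G

instance {β : Type*} [DecidableEq β] (M : Fin 3 → List β) (G v : List β) :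
    Decidable (LetterCompatible M G v) :=
  inferInstanceAs (Decidable (_ ∨ _))

theorem letterCompatible_of_retLang {β : Type*} {M : Fin 3 → List β} {G v : List β}
    (hM : IsReturnMorphism M G) (hv : RetLang M G palPsi v) : LetterCompatible M G v := by
  obtain ⟨n, hn⟩ := hv
  exact hM.infix_letter _ _ hn

/-- Words without `G` that are special on both sides come from a finite list. -/
theorem mem_of_isWeakFor {β : Type*} {M : Fin 3 → List β}
    {G v : List β} {h : β → Bool} {S : List (List β)} (hM : IsReturnMorphism M G)
    (H : IsWeakFor (RetLang M G palPsi) h v) (hG : ¬ G <:+: v)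
    (hS : ∀ e, ∀ t ∈ (M e ++ G).tails, ∀ x ∈ t.inits, ¬ G <:+: x →
      (∀ i, ∃ p, h p = i ∧ LetterCompatible M G (p :: x)) →
      (∀ i, ∃ p, h p = i ∧ LetterCompatible M G (x ++ [p])) → x ∈ S) : v ∈ S := by
  refine forall_letter_infix (P := fun x => ¬ G <:+: x →
      (∀ i, ∃ p, h p = i ∧ LetterCompatible M G (p :: x)) →
      (∀ i, ∃ p, h p = i ∧ LetterCompatible M G (x ++ [p])) → x ∈ S) hS ?_ hG ?_ ?_
  · obtain ⟨p, q, -, h1⟩ := H.exists_left true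
    exact (letterCompatible_of_retLang hM (h1.mono ⟨[p], [q], by simp⟩)).resolve_left hG
  · intro i
    obtain ⟨p, q, h1, h2⟩ := H.exists_left i
    exact ⟨p, h1, letterCompatible_of_retLang hM (h2.mono ⟨[], [q], by simp⟩)⟩
  · intro i
    obtain ⟨p, q, h1, h2⟩ := H.exists_right i
    exact ⟨q, h1, letterCompatible_of_retLang hM (h2.mono ⟨[p], [], by simp⟩)⟩

-- Without `aba`, only `ε`, `a`, `aa` can have neighbours of both classes on each side. None is
-- weak: each has a fixed left letter with right neighbours of both classes.
set_option synthInstance.maxSize 10000 in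
theorem infix_of_isWeakFor_psi {v : List (Fin 3)} (H : IsWeakFor (Lang palPsi) isA v) :
    [0, 1, 0] <:+: v := by
  by_contra hG
  have hv : v ∈ [[], [0], [0, 0]] := by
    refine mem_of_isWeakFor (h := isA) isReturnMorphism_morPsi ?_ hG (by decide)
    rwa [show RetLang morPsi [0, 1, 0] palPsi = Lang palPsi from
      funext fun v => propext (langPsi_iff v)]
  have hmem : ∀ w, w <:+: palPsi 6 → Lang palPsi w := fun w hw => ⟨6, hw⟩
  simp only [List.mem_cons, List.not_mem_nil, or_false] at hv
  rcases hv with rfl | rfl | rfl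
  · exact absurd (H.eq_of_left (p := 0) (q := 0) (p' := 0) (q' := 1) (hmem _ (by decide))
      (hmem _ (by decide)) rfl) (by decide)
  · exact absurd (H.eq_of_left (p := 1) (q := 0) (p' := 1) (q' := 2) (hmem _ (by decide))
      (hmem _ (by decide)) rfl) (by decide)
  · exact absurd (H.eq_of_left (p := 1) (q := 0) (p' := 1) (q' := 1) (hmem _ (by decide))
      (hmem _ (by decide)) rfl) (by decide)

theorem infix_of_isWeakFor_tau {v : List Bool}
    (H : IsWeakFor (RetLang morTau [true, true, true] palPsi) id v) :
    [true, true, true] <:+: v := by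
  by_contra hG
  have hv := mem_of_isWeakFor (S := [[], [true], [true, true], [true, false, true]])
    isReturnMorphism_morTau H hG (by decide)
  have hmem : ∀ w, w <:+: retWord morTau [true, true, true] (palPsi 3) →
    RetLang morTau [true, true, true] palPsi w := fun w hw => ⟨3, hw⟩
  simp only [List.mem_cons, List.not_mem_nil, or_false] at hv
  rcases hv with rfl | rfl | rfl | rfl <;>
  exact absurd (H.eq_of_left (p := true) (q := true) (p' := true) (q' := false)
      (hmem _ (by decide)) (hmem _ (by decide)) rfl) (by decide)

/-- The weak words of the fixed point of `morPsi`. -/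
def weakPsi : ℕ → List (Fin 3)
  | 0 => [0] ++ (retWord morPsi [0, 1, 0] [0] ++ [0])
  | n + 1 => retWord morPsi [0, 1, 0] (weakPsi n)

/-- Every weak word contains `aba`, so it is exceptional or the image of a weak word; the latter is
strictly shorter, and the descent ends at the exceptional word. -/
theorem isWeakFor_psi_iff (v : List (Fin 3)) :
    IsWeakFor (Lang palPsi) isA v ↔ ∃ n, v = weakPsi n := by
  have hL : RetLang morPsi [0, 1, 0] palPsi = Lang palPsi :=
    funext fun v => propext (langPsi_iff v)
  constructor
  · intro H
    induction hn : v.length using Nat.strong_induction_on generalizing v with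
    | _ k ih =>
      have h1 := isColoredReturn_morPsi.isWeakFor_iff (infix_of_isWeakFor_psi H)
      rw [hL] at h1
      rcases h1.1 H with ⟨x, rfl, hx⟩ | h2
      · obtain ⟨n, rfl⟩ := ih x.length (by
          rw [← hn]
          have h3 : ∀ y : List (Fin 3), y.length < (retWord morPsi [0, 1, 0] y).length := by
            intro y
            induction y with
            | nil => decide
            | cons e y ih =>
              have := List.length_pos_iff.2 (isReturnMorphism_morPsi.ne_nil e)
              rw [retWord_cons, List.length_append, List.length_cons]
              omega
          exact h3 x) x hx rfl
        exact ⟨n + 1, rfl⟩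
      · exact ⟨0, h2⟩
  · rintro ⟨n, rfl⟩
    induction n with
    | zero =>
      have := isColoredReturn_morPsi.isWeakFor_exceptional
      rwa [hL] at this
    | succ n ih =>
      have := (isColoredReturn_morPsi.isWeakFor_retWord_iff (weakPsi n)).2 ih
      rwa [hL] at this

/-- The difference sequences of the weak bispecial factors. -/
def weakDiff : ℕ → List Bool
  | 0 => [true, false] ++ (retWord morTau [true, true, true] [0] ++ [false, true])
  | n + 1 => retWord morTau [true, true, true] (weakPsi n)

theorem isWeakFor_tau_iff (v : List Bool) :
    IsWeakFor (RetLang morTau [true, true, true] palPsi) id v ↔ ∃ n, v = weakDiff n := by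
  constructor
  · intro H
    rcases (isColoredReturn_morTau.isWeakFor_iff (infix_of_isWeakFor_tau H)).1 H with
      ⟨x, rfl, hx⟩ | h2
    · obtain ⟨n, rfl⟩ := (isWeakFor_psi_iff x).1 hx
      exact ⟨n + 1, rfl⟩
    · exact ⟨0, h2⟩
  · rintro ⟨_ | n, rfl⟩
    · exact isColoredReturn_morTau.isWeakFor_exceptional
    · exact (isColoredReturn_morTau.isWeakFor_retWord_iff (weakPsi n)).2
        ((isWeakFor_psi_iff _).2 ⟨n, rfl⟩)

theorem reverse_weakPsi (n : ℕ) : (weakPsi n).reverse = weakPsi n := by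
  induction n with
  | zero => decide
  | succ n ih => rw [weakPsi, isReturnMorphism_morPsi.reverse_retWord, ih]

theorem reverse_weakDiff (n : ℕ) : (weakDiff n).reverse = weakDiff n := by
  cases n with
  | zero => decide
  | succ n => rw [weakDiff, isReturnMorphism_morTau.reverse_retWord, reverse_weakPsi]

/-! ### Words and their difference sequences -/

/-- The word with first letter `s` and sequence of differences `d`. -/
def integ : Bool → List Bool → Word
  | s, [] => [s]
  | s, b :: d => s :: integ (xor s b) d

/-- The last letter of `integ s d`. -/
def endBit (s : Bool) (d : List Bool) : Bool := d.foldl xor s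

/-- Whether an antimorphism exchanges the letters. -/
def Anti.flips : Anti → Bool
  | Anti.R => false
  | Anti.E => true

@[simp] theorem endBit_nil (s : Bool) : endBit s [] = s := rfl

@[simp] theorem endBit_cons (s b : Bool) (d : List Bool) :
    endBit s (b :: d) = endBit (xor s b) d := rfl

theorem endBit_append (s : Bool) (d d' : List Bool) :
    endBit s (d ++ d') = endBit (endBit s d) d' := by
  simp [endBit]

theorem endBit_xor (s t : Bool) (d : List Bool) : endBit (xor s t) d = xor (endBit s d) t := by
  induction d generalizing s with
  | nil => rfl
  | cons b d ih =>
    rw [endBit_cons, endBit_cons, ← ih]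
    congr 1
    cases s <;> cases t <;> cases b <;> rfl

theorem endBit_reverse (s : Bool) (d : List Bool) : endBit (endBit s d) d.reverse = s := by
  induction d generalizing s with
  | nil => rfl
  | cons b d ih =>
    rw [List.reverse_cons, endBit_append, endBit_cons s b d, ih]
    cases s <;> cases b <;> rfl

@[simp] theorem length_integ (s : Bool) (d : List Bool) : (integ s d).length = d.length + 1 := by
  induction d generalizing s with
  | nil => rfl
  | cons b d ih => simp [integ, ih]

theorem integ_append_cons (s b : Bool) (d d' : List Bool) :
    integ s (d ++ b :: d') = integ s d ++ integ (xor (endBit s d) b) d' := by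
  induction d generalizing s with
  | nil => rfl
  | cons c d ih => simp [integ, ih]

theorem integ_append (s : Bool) (d d' : List Bool) :
    integ s (d ++ d') = integ s d ++ (integ (endBit s d) d').tail := by
  cases d' with
  | nil => simp [integ]
  | cons b d' => rw [integ_append_cons]; rfl

theorem integ_injective {s s' : Bool} {d d' : List Bool} (h : integ s d = integ s' d') :
    s = s' ∧ d = d' := by
  induction d generalizing s s' d' with
  | nil =>
    cases d' with
    | nil => simpa [integ] using h
    | cons b d' =>
      have := congrArg List.length h
      simp at this
  | cons b d ih =>
    cases d' with
    | nil =>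
      have := congrArg List.length h
      simp at this
    | cons b' d' =>
      simp only [integ, List.cons.injEq] at h
      obtain ⟨rfl, h⟩ := h
      obtain ⟨h1, rfl⟩ := ih h
      exact ⟨rfl, by rw [Bool.xor_right_inj.1 h1]⟩

theorem exists_eq_integ {w : Word} (h : w ≠ []) : ∃ s d, w = integ s d := by
  induction w with
  | nil => exact absurd rfl h
  | cons s w ih =>
    by_cases hw : w = []
    · exact ⟨s, [], by rw [hw]; rfl⟩
    · obtain ⟨s', d, rfl⟩ := ih hw
      exact ⟨s, xor s s' :: d, by simp [integ]⟩

theorem integ_prefix_iff {s s' : Bool} {d d' : List Bool} :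
    integ s d <+: integ s' d' ↔ s = s' ∧ d <+: d' := by
  constructor
  · rintro ⟨t, ht⟩
    rcases eq_or_ne t [] with rfl | h
    · rw [List.append_nil] at ht
      obtain ⟨rfl, rfl⟩ := integ_injective ht
      exact ⟨rfl, List.prefix_rfl⟩
    · obtain ⟨b, e, rfl⟩ := exists_eq_integ h
      have h1 : integ s (d ++ (xor (endBit s d) b) :: e) = integ s' d' := by
        rw [← ht, integ_append_cons]
        simp
      obtain ⟨rfl, rfl⟩ := integ_injective h1
      exact ⟨rfl, List.prefix_append _ _⟩
  · rintro ⟨rfl, e, rfl⟩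
    rw [integ_append]
    exact List.prefix_append _ _

theorem infix_of_integ_infix {s s' : Bool} {d d' : List Bool} (h : integ s d <:+: integ s' d') :
    d <:+: d' := by
  obtain ⟨A, B, hAB⟩ := h
  rw [List.append_assoc] at hAB
  induction A generalizing s' d' with
  | nil => exact (integ_prefix_iff.1 ⟨B, hAB⟩).2.isInfix
  | cons a A ih =>
    cases d' with
    | nil =>
      have := congrArg List.length hAB
      simp at this
    | cons b d' =>
      simp only [integ, List.cons_append, List.cons.injEq] at hAB
      exact (ih hAB.2).trans (List.suffix_cons b d').isInfix

theorem exists_integ_infix {d d' : List Bool} (h : d <:+: d') (s' : Bool) :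
    ∃ s, integ s d <:+: integ s' d' := by
  obtain ⟨A, B, rfl⟩ := h
  refine ⟨endBit s' A, ?_⟩
  refine List.IsInfix.trans ?_ (integ_prefix_iff.2 ⟨rfl, List.prefix_append (A ++ d) B⟩).isInfix
  cases hA : A.reverse with
  | nil =>
    rw [List.reverse_eq_nil_iff] at hA
    subst hA
    exact List.infix_rfl
  | cons b A' =>
    rw [List.reverse_eq_cons_iff] at hA
    subst hA
    rw [List.append_assoc, List.singleton_append, integ_append_cons, endBit_append]
    exact (List.suffix_append _ _).isInfix

theorem map_not_integ (s : Bool) (d : List Bool) : (integ s d).map not = integ (!s) d := by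
  induction d generalizing s with
  | nil => rfl
  | cons b d ih => simp [integ, ih]

theorem reverse_integ (s : Bool) (d : List Bool) :
    (integ s d).reverse = integ (endBit s d) d.reverse := by
  induction d generalizing s with
  | nil => rfl
  | cons b d ih =>
    rw [integ, List.reverse_cons, ih, List.reverse_cons, integ_append_cons, endBit_cons,
      endBit_reverse]
    simp [integ]

/-- Exchanging letters does not change differences, so `R` and `E` act alike on them and are told
apart only by the first letter. -/
theorem app_integ (t : Anti) (s : Bool) (d : List Bool) :
    t.app (integ s d) = integ (xor (endBit s d) t.flips) d.reverse := by
  cases t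
  · simp [Anti.app, Anti.flips, reverse_integ]
  · rw [Anti.app, map_not_integ, reverse_integ, ← Bool.xor_true, endBit_xor]
    rfl

theorem isPal_integ_iff (t : Anti) (s : Bool) (d : List Bool) :
    IsPal t (integ s d) ↔ endBit s d = xor s t.flips ∧ d.reverse = d := by
  rw [IsPal, app_integ]
  constructor
  · intro h
    obtain ⟨h1, h2⟩ := integ_injective h
    refine ⟨?_, h2⟩
    rw [← Bool.xor_false (endBit s d), ← Bool.xor_self t.flips, ← Bool.xor_assoc, h1]
  · rintro ⟨h1, h2⟩
    rw [h1, h2]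
    simp

theorem Anti.app_cons (t : Anti) (b : Bool) (w : Word) :
    t.app (b :: w) = t.app w ++ [xor b t.flips] := by
  cases t <;> simp [Anti.app, Anti.flips]

theorem Anti.app_comm (t t' : Anti) (w : Word) : t.app (t'.app w) = t'.app (t.app w) := by
  cases t <;> cases t' <;> simp [Anti.app]

theorem Anti.eq_of_isPal {t t' : Anti} {w : Word} (hw : w ≠ []) (h : IsPal t w)
    (h' : IsPal t' w) : t = t' := by
  obtain ⟨s, d, rfl⟩ := exists_eq_integ hw
  rw [isPal_integ_iff] at h h'
  have h1 := h.1.symm.trans h'.1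
  revert h1
  cases t <;> cases t' <;> cases s <;> simp [Anti.flips]

/-! ### Palindromic prefixes and pseudopalindromic closure -/

/-- A criterion for the pseudopalindromic closure. -/
theorem closure_eq {t : Anti} {w X : Word} (hX : IsPal t X) (hp : w <+: X)
    (hs : ∀ q, q <:+ w → IsPal t q → q.length + X.length ≤ 2 * w.length) : closure t w = X := by
  have hlen : X.length ≤ 2 * w.length := by
    simpa using hs [] List.nil_suffix (by cases t <;> rfl)
  rcases closure_shortest t w X hX hp with h | h
  · exfalso
    have hC := closure_isPal t w
    rw [closure] at hC h
    generalize Nat.find (exists_isPal_append t w) = i at hC h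
    -- The part of `w` that the closure does not mirror is a `t`-palindromic suffix; the bound on
    -- its length contradicts a closure shorter than `X`.
    have h1 : IsPal t (w.drop i) := by
      have h2 : t.app (w.take i ++ w.drop i ++ t.app (w.take i)) =
          w.take i ++ w.drop i ++ t.app (w.take i) := by
        rw [List.take_append_drop]
        exact hC
      simp only [Anti.app_append, Anti.app_app, List.append_assoc] at h2
      exact List.append_cancel_right (List.append_cancel_left h2)
    have h2 := hs _ (List.drop_suffix i w) h1
    simp only [List.length_append, Anti.length_app, List.length_take, List.length_drop] at h h2
    omega
  · exact h.symm

/-- The palindromic prefixes of `M(y) G` that are not shorter than `G`. -/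
theorem IsReturnMorphism.exists_of_pal_prefix {α β : Type*} {M : α → List β} {G : List β}
    (hM : IsReturnMorphism M G) {y : List α} {d : List β} (hd : d <+: retWord M G y)
    (hpal : d.reverse = d) (hlen : G.length ≤ d.length) :
    ∃ x, x <+: y ∧ x.reverse = x ∧ d = retWord M G x := by
  have h1 : G <+: d := List.prefix_of_prefix_length_le (hM.prefix_retWord y) hd hlen
  have h2 : G <:+ d := by
    rw [← List.reverse_prefix, hpal, hM.palG]
    exact h1
  obtain ⟨k, rfl⟩ := h2
  obtain ⟨B, hB⟩ := hd
  obtain ⟨x, y', rfl, rfl, -⟩ := hM.exists_cut y k B (by rw [← hB, List.append_assoc])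
  refine ⟨x, List.prefix_append _ _, ?_, rfl⟩
  apply hM.retWord_injective
  rw [← hM.reverse_retWord]
  exact hpal

/-- A palindromic prefix of length at least 3 begins and ends with `aba`, so it desubstitutes to a
palindromic prefix of `palPsi (n - 2)`. -/
theorem exists_of_pal_prefix_palPsi (n : ℕ) {x : List (Fin 3)} (hx : x <+: palPsi n)
    (hpal : x.reverse = x) : ∃ j, x = palPsi j := by
  induction n using Nat.twoStepInduction generalizing x with
  | zero => exact ⟨0, List.prefix_nil.1 hx⟩
  | one =>
    rcases List.prefix_cons_iff.1 hx with rfl | ⟨t, rfl, ht⟩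
    · exact ⟨0, rfl⟩
    · rw [List.prefix_nil.1 ht]
      exact ⟨1, rfl⟩
  | more n ih _ =>
    by_cases h3 : 3 ≤ x.length
    · obtain ⟨y, hy, hy', rfl⟩ := isReturnMorphism_morPsi.exists_of_pal_prefix hx hpal h3
      obtain ⟨j, rfl⟩ := ih hy hy'
      exact ⟨j + 2, rfl⟩
    · have h4 : x <+: [0, 1, 0] := List.prefix_of_prefix_length_le hx
        (isReturnMorphism_morPsi.prefix_retWord _) (by simp; omega)
      have key : ∀ x ∈ [(0 : Fin 3), 1, 0].inits, x.reverse = x → x = [] ∨ x = [0] ∨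
        x = [0, 1, 0] := by decide
      rcases key x ((List.mem_inits _ _).2 h4) hpal with rfl | rfl | rfl
      · exact ⟨0, rfl⟩
      · exact ⟨1, rfl⟩
      · exact ⟨2, rfl⟩

/-- The difference sequences of the words `w_n`, for `n ≥ 2`. -/
def prefDiff (n : ℕ) : List Bool := retWord morTau [true, true, true] (palPsi n)

theorem reverse_prefDiff (n : ℕ) : (prefDiff n).reverse = prefDiff n := by
  rw [prefDiff, isReturnMorphism_morTau.reverse_retWord, reverse_palPsi]

theorem prefDiff_next_prefix (n : ℕ) : prefDiff n ++ [isA (nextPsi n)] <+: prefDiff (n + 1) := by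
  obtain ⟨t, ht⟩ := palPsi_next_prefix n
  have key : ∀ e : Fin 3, [true, true, true] ++ [isA e] <+: morTau e ++ [true, true, true] := by
    decide
  rw [prefDiff, prefDiff, ← ht, List.append_assoc, retWord_append, retWord, List.append_assoc,
    List.prefix_append_right_inj]
  exact (key _).trans (isReturnMorphism_morTau.prefix_retWord_cons _ _)

/-- The number of ones in `τ(e)` is even only for `e = c`, and `111` contributes one more change.
Likewise, `ψ(e)` has an even number of letters other than `c` only for `e = c`. -/
theorem endBit_retWord_morTau (s : Bool) (x : List (Fin 3)) :
    endBit s (retWord morTau [true, true, true] x) =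
      !(xor s (endBit false (x.map (· != 2)))) := by
  induction x generalizing s with
  | nil => cases s <;> rfl
  | cons e x ih =>
    have key : ∀ (e : Fin 3) s, endBit s (morTau e) = xor s (e != 2) := by decide
    rw [retWord_cons, endBit_append, ih, key, List.map_cons, endBit_cons, Bool.xor_comm false,
      Bool.xor_false, ← Bool.false_xor (e != 2), endBit_xor, Bool.false_xor]
    cases s <;> cases (e != 2) <;> cases endBit false (x.map (· != 2)) <;> rfl

theorem endBit_retWord_morPsi (s : Bool) (x : List (Fin 3)) :
    endBit s ((retWord morPsi [0, 1, 0] x).map (· != 2)) =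
      !(xor s (endBit false (x.map (· != 2)))) := by
  induction x generalizing s with
  | nil => cases s <;> rfl
  | cons e x ih =>
    have key : ∀ (e : Fin 3) s, endBit s ((morPsi e).map (· != 2)) = xor s (e != 2) := by decide
    rw [retWord_cons, List.map_append, endBit_append, ih, key, List.map_cons, endBit_cons,
      Bool.xor_comm false, Bool.xor_false, ← Bool.false_xor (e != 2), endBit_xor, Bool.false_xor]
    cases s <;> cases (e != 2) <;> cases endBit false (x.map (· != 2)) <;> rfl

theorem endBit_prefDiff (n : ℕ) :
    endBit true (prefDiff n) = endBit false ((palPsi n).map (· != 2)) := by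
  rw [prefDiff, endBit_retWord_morTau]
  simp

theorem endBit_prefDiff_add_two (n : ℕ) :
    endBit true (prefDiff (n + 2)) = !(endBit true (prefDiff n)) := by
  rw [endBit_prefDiff, endBit_prefDiff, palPsi, endBit_retWord_morPsi]
  simp

/-- The last letter and the next difference always combine to the letter `1`; this is where the
directive sequence `1^ω` comes from. -/
theorem endBit_prefDiff_eq (n : ℕ) : endBit true (prefDiff n) = !(isA (nextPsi n)) := by
  induction n using Nat.twoStepInduction with
  | zero => rfl
  | one => rfl
  | more n ih _ =>
    have key : ∀ e : Fin 3, isA (![2, 0, 0] e) = !(isA e) := by decide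
    rw [endBit_prefDiff_add_two, ih, nextPsi, key]

theorem flips_thetaP_add_two (n : ℕ) : (thetaP (n + 2)).flips = !(thetaP n).flips := by
  unfold thetaP
  have : n % 4 < 4 := Nat.mod_lt _ (by decide)
  by_cases h : n % 4 < 2
  · rw [if_pos h, if_neg (by omega)]
    rfl
  · rw [if_neg h, if_pos (by omega)]
    rfl

theorem endBit_prefDiff_eq_flips (n : ℕ) :
    endBit true (prefDiff n) = !(thetaP (n + 1)).flips := by
  induction n using Nat.twoStepInduction with
  | zero => rfl
  | one => rfl
  | more n ih _ =>
    rw [endBit_prefDiff_add_two, ih, show n + 2 + 1 = n + 1 + 2 from rfl, flips_thetaP_add_two]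

/-- The word `w_{n+2}` (see `wP_eq`). -/
def palWord (n : ℕ) : Word := integ true (prefDiff n)

theorem palWord_ne_nil (n : ℕ) : palWord n ≠ [] := by
  intro h
  have := congrArg List.length h
  simp [palWord] at this

theorem isPal_palWord (n : ℕ) : IsPal (thetaP (n + 1)) (palWord n) :=
  (isPal_integ_iff _ _ _).2 ⟨by rw [endBit_prefDiff_eq_flips]; simp, reverse_prefDiff n⟩

theorem palWord_next_prefix (n : ℕ) : palWord n ++ [true] <+: palWord (n + 1) := by
  have h1 : palWord n ++ [true] = integ true (prefDiff n ++ [isA (nextPsi n)]) := by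
    rw [integ_append_cons, endBit_prefDiff_eq]
    simp [palWord, integ]
  rw [h1]
  exact integ_prefix_iff.2 ⟨rfl, prefDiff_next_prefix n⟩

theorem palWord_prefix_of_le {m n : ℕ} (h : m ≤ n) : palWord m <+: palWord n := by
  induction n, h using Nat.le_induction with
  | base => exact List.prefix_rfl
  | succ n _ ih => exact ih.trans ((List.prefix_append _ _).trans (palWord_next_prefix n))

theorem exists_of_pal_prefix_palWord {n : ℕ} {t : Anti} {Q : Word} (hQ : Q <+: palWord n)
    (hpal : IsPal t Q) : Q.length ≤ 3 ∨ ∃ j, Q = palWord j := by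
  rcases eq_or_ne Q [] with rfl | h
  · exact Or.inl (by simp)
  obtain ⟨s, d, rfl⟩ := exists_eq_integ h
  obtain ⟨rfl, hd⟩ := integ_prefix_iff.1 hQ
  by_cases h3 : 3 ≤ d.length
  · right
    obtain ⟨x, hx, hx', rfl⟩ := isReturnMorphism_morTau.exists_of_pal_prefix hd
      ((isPal_integ_iff _ _ _).1 hpal).2 h3
    obtain ⟨j, rfl⟩ := exists_of_pal_prefix_palPsi n hx hx'
    exact ⟨j, rfl⟩
  · left
    rw [length_integ]
    omega

/-- Strip the two outer letters of `q` and reflect by `t'`: the core becomes a `t`-palindromic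
prefix of `w`, and the letter after it is forced. -/
theorem exists_pal_prefix_of_suffix {t t' : Anti} {w q : Word} (hw : IsPal t' w)
    (hq : q <:+ w ++ [true]) (hpal : IsPal t q) (hlen : 2 ≤ q.length) :
    ∃ Q, IsPal t Q ∧ Q.length + 2 = q.length ∧
      Q ++ [!(xor t.flips t'.flips)] <+: w := by
  rcases List.eq_nil_or_concat q with rfl | ⟨q, b, rfl⟩
  · simp at hlen
  rw [List.concat_eq_append] at *
  obtain ⟨A, hA⟩ := hq
  rw [← List.append_assoc] at hA
  obtain ⟨rfl, hb⟩ := List.append_inj' hA rfl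
  simp only [List.cons.injEq, and_true] at hb
  subst hb
  cases q with
  | nil => simp at hlen
  | cons z q =>
    rw [IsPal, Anti.app_append, show t.app [true] = [!t.flips] by
      cases t <;> rfl, List.singleton_append, List.cons_append, List.cons.injEq] at hpal
    obtain ⟨rfl, hpal⟩ := hpal
    rw [Anti.app_cons] at hpal
    have hpal' : t.app q = q := (List.append_inj' hpal rfl).1
    refine ⟨t'.app q, ?_, ?_, ?_⟩
    · rw [IsPal, Anti.app_comm, hpal']
    · simp [Anti.length_app]
    · rw [← hw, Anti.app_append, Anti.app_cons]
      refine List.IsPrefix.trans ?_ (List.prefix_append _ _)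
      rw [← Bool.not_xor]

/-! ### Length identities and the computation of the closures -/

/-- The total weight of the letters of a word. -/
def weight (w : Fin 3 → ℕ) (x : List (Fin 3)) : ℕ := (x.map w).sum

theorem weight_append (w : Fin 3 → ℕ) (x y : List (Fin 3)) :
    weight w (x ++ y) = weight w x + weight w y := by
  simp [weight]

theorem weight_palPsi_add_two (w : Fin 3 → ℕ) (n : ℕ) :
    weight w (palPsi (n + 2)) =
      weight (fun e => weight w (morPsi e)) (palPsi n) + weight w [0, 1, 0] := by
  rw [palPsi, retWord, weight_append]
  congr 1
  induction palPsi n with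
  | nil => rfl
  | cons e x ih =>
    rw [List.flatMap_cons, weight_append, ih]
    simp [weight]

/-- Quantifying over all weights makes the induction work, as passing through `ψ` replaces `w` by
the weights of the images. The extra letter alternates between `a` and `c`. -/
theorem weight_palPsi_odd (m : ℕ) :
    (∀ w, weight w (palPsi (4 * m + 1)) = 2 * weight w (palPsi (4 * m)) + w 0) ∧
      ∀ w, weight w (palPsi (4 * m + 3)) = 2 * weight w (palPsi (4 * m + 2)) + w 2 := by
  have h2 : ∀ m, (∀ w, weight w (palPsi (4 * m + 1)) = 2 * weight w (palPsi (4 * m)) + w 0) →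
      ∀ w, weight w (palPsi (4 * m + 3)) = 2 * weight w (palPsi (4 * m + 2)) + w 2 := by
    intro m h w
    rw [weight_palPsi_add_two w (4 * m + 1), weight_palPsi_add_two w (4 * m), h]
    simp [weight, morPsi]
    omega
  induction m with
  | zero =>
    have h1 : ∀ w, weight w (palPsi (4 * 0 + 1)) = 2 * weight w (palPsi (4 * 0)) + w 0 := by
      simp [palPsi, weight]
    exact ⟨h1, h2 0 h1⟩
  | succ m ih =>
    have h1 : ∀ w, weight w (palPsi (4 * (m + 1) + 1)) =
        2 * weight w (palPsi (4 * (m + 1))) + w 0 := by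
      intro w
      rw [show 4 * (m + 1) + 1 = 4 * m + 3 + 2 by ring, show 4 * (m + 1) = 4 * m + 2 + 2 by ring,
        weight_palPsi_add_two w (4 * m + 3), weight_palPsi_add_two w (4 * m + 2), ih.2]
      simp [weight, morPsi]
      omega
    exact ⟨h1, h2 _ h1⟩

theorem weight_palPsi_even (m : ℕ) (w : Fin 3 → ℕ) :
    weight w (palPsi (2 * m + 4)) + weight w (palPsi (2 * m)) =
      2 * weight w (palPsi (2 * m + 3)) := by
  induction m generalizing w with
  | zero => simp [palPsi, weight, retWord, morPsi]; omega
  | succ m ih =>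
    have h := ih (fun e => weight w (morPsi e))
    have h1 := weight_palPsi_add_two w (2 * m + 4)
    have h2 := weight_palPsi_add_two w (2 * m)
    have h3 := weight_palPsi_add_two w (2 * m + 3)
    rw [show 2 * (m + 1) + 4 = 2 * m + 4 + 2 by ring, show 2 * (m + 1) = 2 * m + 2 by ring,
      show 2 * m + 2 + 3 = 2 * m + 3 + 2 by ring]
    omega

theorem length_palWord (n : ℕ) :
    (palWord n).length = weight (fun e => (morTau e).length) (palPsi n) + 4 := by
  rw [palWord, length_integ, prefDiff, retWord]
  simp [weight, List.length_flatMap]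

theorem length_palWord_even (m : ℕ) :
    (palWord (2 * m + 4)).length + (palWord (2 * m)).length =
      2 * (palWord (2 * m + 3)).length := by
  have := weight_palPsi_even m (fun e => (morTau e).length)
  simp only [length_palWord]
  omega

theorem length_palWord_odd (m : ℕ) :
    (palWord (4 * m + 1)).length + 3 = 2 * (palWord (4 * m)).length ∧
      (palWord (4 * m + 3)).length = 2 * (palWord (4 * m + 2)).length + 2 := by
  have h1 := (weight_palPsi_odd m).1 fun e => (morTau e).length
  have h2 := (weight_palPsi_odd m).2 fun e => (morTau e).length
  simp only [length_palWord, h1, h2]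
  simp [morTau]
  omega

theorem length_palWord_lt (n : ℕ) : (palWord n).length < (palWord (n + 1)).length := by
  have := (palWord_next_prefix n).length_le
  simp at this
  omega

theorem length_palWord_strictMono : StrictMono fun n => (palWord n).length :=
  strictMono_nat_of_lt_succ length_palWord_lt

/-- Here the antimorphism changes, so the reflected core must be followed by `0`. Every `palWord j`
shorter than `palWord n` is followed by `1`, so only cores of length at most 3 survive. -/
theorem length_le_of_pal_suffix_even {n : ℕ} (hn : n % 2 = 0) {q : Word}
    (hq : q <:+ palWord n ++ [true]) (hpal : IsPal (thetaP (n + 2)) q) :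
    q.length + (palWord (n + 1)).length ≤ 2 * (palWord n ++ [true]).length := by
  have hlen : q.length ≤ 5 ∧ (n % 4 = 2 → q.length = 0) := by
    have hE : n % 4 = 2 → thetaP (n + 2) = Anti.E := fun h => if_pos (by omega)
    have h4 : palWord 0 <+: palWord n := palWord_prefix_of_le (Nat.zero_le n)
    by_cases h2 : 2 ≤ q.length
    · obtain ⟨Q, hQ, hQl, hQp⟩ := exists_pal_prefix_of_suffix (isPal_palWord n) hq hpal h2
      have hf : (thetaP (n + 1)).flips = !(thetaP (n + 2)).flips := by
        unfold thetaP
        have : n % 4 = 0 ∨ n % 4 = 2 := by omega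
        rcases this with h | h
        · rw [if_pos (by omega), if_neg (by omega)]; rfl
        · rw [if_neg (by omega), if_pos (by omega)]; rfl
      rw [hf, Bool.xor_not_self, Bool.not_true] at hQp
      have h3 : Q.length ≤ 3 := by
        rcases exists_of_pal_prefix_palWord ((List.prefix_append _ _).trans hQp) hQ with
          h | ⟨j, rfl⟩
        · exact h
        · exfalso
          have hj : j < n := by
            have := hQp.length_le
            rw [List.length_append, List.length_singleton] at this
            exact length_palWord_strictMono.lt_iff_lt.1 (by exact this)
          have h5 := (palWord_next_prefix j).trans (palWord_prefix_of_le hj)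
          have h6 := List.prefix_of_prefix_length_le hQp h5 (by simp)
          simp [List.prefix_append_right_inj] at h6
      refine ⟨by omega, fun h => ?_⟩
      rw [hE h] at hQ
      have h5 : Q ++ [false] <+: palWord 0 := List.prefix_of_prefix_length_le hQp h4 (by
        simp only [List.length_append, List.length_singleton]
        have : (palWord 0).length = 4 := by decide
        omega)
      -- The `E`-palindromic proper prefixes of `1010` are `ε` and `10`, both followed by `1`.
      have key : ∀ t ∈ (palWord 0).inits, IsPal Anti.E t.dropLast → t.getLast? ≠ some false := by
        decide
      exact absurd (by simp) (key _ ((List.mem_inits _ _).2 h5) (by simpa using hQ))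
    · refine ⟨by omega, fun h => ?_⟩
      by_contra h0
      rw [hE h] at hpal
      obtain ⟨b, rfl⟩ := List.length_eq_one_iff.1 (show q.length = 1 by omega)
      revert hpal
      cases b <;> decide
  rw [List.length_append, List.length_singleton]
  have : n % 4 = 0 ∨ n % 4 = 2 := by omega
  rcases this with h | h
  · obtain ⟨m, rfl⟩ : ∃ m, n = 4 * m := ⟨n / 4, by omega⟩
    have := (length_palWord_odd m).1
    omega
  · obtain ⟨m, rfl⟩ : ∃ m, n = 4 * m + 2 := ⟨n / 4, by omega⟩
    have := (length_palWord_odd m).2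
    have := hlen.2 h
    rw [show 4 * m + 2 + 1 = 4 * m + 3 from rfl]
    omega

/-- The core is short or some `palWord j` of the required type. The types exclude `j = 2m + 1` and
`j = 2m + 2`, and `length_palWord_even` is exactly the bound needed for `j ≤ 2m`. -/
theorem length_le_of_pal_suffix_odd {m : ℕ} {q : Word}
    (hq : q <:+ palWord (2 * m + 3) ++ [true]) (hpal : IsPal (thetaP (2 * m + 5)) q) :
    q.length + (palWord (2 * m + 4)).length ≤ 2 * (palWord (2 * m + 3) ++ [true]).length := by
  have hlen : q.length ≤ (palWord (2 * m)).length + 2 := by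
    by_cases h2 : 2 ≤ q.length
    · obtain ⟨Q, hQ, hQl, hQp⟩ := exists_pal_prefix_of_suffix (isPal_palWord _) hq hpal h2
      rcases exists_of_pal_prefix_palWord ((List.prefix_append _ _).trans hQp) hQ with
        h | ⟨j, rfl⟩
      · rw [length_palWord]
        omega
      · have hj : j < 2 * m + 3 := by
          have := hQp.length_le
          rw [List.length_append, List.length_singleton] at this
          exact length_palWord_strictMono.lt_iff_lt.1 (by exact this)
        have ht := Anti.eq_of_isPal (palWord_ne_nil j) hQ (isPal_palWord j)
        have hj' : j ≤ 2 * m := by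
          by_contra hj'
          have h4 : (2 * m) % 4 = 0 ∨ (2 * m) % 4 = 2 := by omega
          have : j = 2 * m + 1 ∨ j = 2 * m + 2 := by omega
          unfold thetaP at ht
          rcases this with rfl | rfl <;> rcases h4 with h4 | h4
          · rw [if_pos (by omega), if_neg (by omega)] at ht; cases ht
          · rw [if_neg (by omega), if_pos (by omega)] at ht; cases ht
          · rw [if_pos (by omega), if_neg (by omega)] at ht; cases ht
          · rw [if_neg (by omega), if_pos (by omega)] at ht; cases ht
        have := length_palWord_strictMono.monotone hj'
        omega
    · omega
  have := length_palWord_even m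
  rw [List.length_append, List.length_singleton]
  omega

theorem closure_palWord (n : ℕ) :
    closure (thetaP (n + 2)) (palWord n ++ [true]) = palWord (n + 1) := by
  refine closure_eq (isPal_palWord (n + 1)) (palWord_next_prefix n) fun q hq hpal => ?_
  rcases Nat.even_or_odd' n with ⟨m, rfl | rfl⟩
  · exact length_le_of_pal_suffix_even (by omega) hq hpal
  · cases m with
    | zero =>
      -- The general odd case compares with a `palWord` three indices earlier, so `n = 1` is checked
      -- directly.
      have key : ∀ t ∈ (palWord 1 ++ [true]).tails, IsPal Anti.R t →
          t.length + (palWord 2).length ≤ 2 * (palWord 1 ++ [true]).length := by decide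
      exact key q ((List.mem_tails _ _).2 hq) hpal
    | succ m => exact length_le_of_pal_suffix_odd hq hpal

theorem wP_one : wP 1 = [true, false] := by
  have key : ∀ t ∈ [true].tails, IsPal Anti.E t → t.length + 2 ≤ 2 * 1 := by decide
  exact closure_eq (t := Anti.E) (by decide) (by decide) fun q hq hpal =>
    key q ((List.mem_tails _ _).2 hq) hpal

/-- The words `w_n`, for `n ≥ 2`, by their difference sequences. -/
theorem wP_eq (n : ℕ) : wP (n + 2) = palWord n := by
  induction n with
  | zero =>
    have key : ∀ t ∈ [true, false, true].tails, IsPal Anti.E t → t.length + 4 ≤ 2 * 3 := by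
      decide
    have h1 : wP 2 = closure Anti.E (wP 1 ++ [true]) := rfl
    rw [h1, wP_one]
    exact closure_eq (by decide) (by decide) fun q hq hpal =>
      key q ((List.mem_tails _ _).2 hq) hpal
  | succ n ih =>
    have h1 : wP (n + 1 + 2) = closure (thetaP (n + 2)) (wP (n + 2) ++ [true]) := rfl
    rw [h1, ih, closure_palWord]

/-! ### Factors and weak bispecial factors in terms of differences -/

theorem isFactor_uP_iff_exists_infix {v : Word} : IsFactor uP v ↔ ∃ n, v <:+: wP n := by
  constructor
  · rintro ⟨i, hi⟩
    have hlen : i + v.length ≤ (wP (i + v.length)).length := le_length_pref _ _ _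
    refine ⟨i + v.length, ?_⟩
    have h1 : v = ((wP (i + v.length)).drop i).take v.length := by
      apply List.ext_getElem
      · simp only [List.length_take, List.length_drop]
        omega
      · intro k hk _
        rw [List.getElem_take, List.getElem_drop]
        conv_lhs => rw [List.getElem_of_eq hi]
        rw [List.getElem_map, List.getElem_range]
        exact word_eq _ _ _ _ (show i + k < (wP (i + v.length)).length by omega)
    have h2 := (List.take_prefix v.length ((wP (i + v.length)).drop i)).isInfix.trans
      (List.drop_suffix i (wP (i + v.length))).isInfix
    rwa [← h1] at h2
  · rintro ⟨n, A, B, hAB⟩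
    refine ⟨A.length, List.ext_getElem (by simp) fun k hk _ => ?_⟩
    rw [List.getElem_map, List.getElem_range]
    have hlen : A.length + k < (wP n).length := by
      rw [← hAB, List.length_append, List.length_append]
      omega
    rw [uP, word_eq deltaP thetaP n _ hlen]
    have h1 : (pref deltaP thetaP n)[A.length + k] = (A ++ v ++ B)[A.length + k]'(by
        rw [hAB]; exact hlen) := List.getElem_of_eq hAB.symm _
    rw [h1, List.getElem_append_left (by rw [List.length_append]; omega),
      List.getElem_append_right (by omega)]
    simp

theorem app_infix_palWord {n : ℕ} {v : Word} (h : v <:+: palWord n) :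
    (thetaP (n + 1)).app v <:+: palWord n := by
  obtain ⟨A, B, hAB⟩ := h
  refine ⟨(thetaP (n + 1)).app B, (thetaP (n + 1)).app A, ?_⟩
  rw [← isPal_palWord n, ← hAB]
  simp [Anti.app_append]

/-- `palWord (4 * n)` is an `E`-palindrome and `palWord (4 * n + 1)` a palindrome; reflecting in
both composes to the exchange of letters. -/
theorem map_not_infix_palWord {n : ℕ} {v : Word} (h : v <:+: palWord n) :
    v.map not <:+: palWord (4 * n + 1) := by
  have h1 := app_infix_palWord (h.trans (palWord_prefix_of_le (by omega : n ≤ 4 * n)).isInfix)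
  rw [show thetaP (4 * n + 1) = Anti.E from if_pos (by omega)] at h1
  have h2 := app_infix_palWord
    (h1.trans (palWord_prefix_of_le (Nat.le_succ (4 * n))).isInfix)
  rw [show thetaP (4 * n + 1 + 1) = Anti.R from if_neg (by omega)] at h2
  simpa [Anti.app] using h2

theorem isFactor_uP_integ_iff (s : Bool) (d : List Bool) :
    IsFactor uP (integ s d) ↔ RetLang morTau [true, true, true] palPsi d := by
  rw [isFactor_uP_iff_exists_infix]
  constructor
  · rintro ⟨n, hn⟩
    have h1 : integ s d <:+: palWord n := by
      rw [← wP_eq]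
      exact hn.trans (pref_prefix_of_le _ _ (Nat.le_add_right n 2)).isInfix
    exact ⟨n, infix_of_integ_infix h1⟩
  · rintro ⟨n, hn⟩
    obtain ⟨s', h1⟩ := exists_integ_infix hn true
    rcases Bool.eq_or_eq_not s s' with rfl | rfl
    · exact ⟨n + 2, by rw [wP_eq]; exact h1⟩
    · have h2 := map_not_infix_palWord (n := n) h1
      rw [map_not_integ] at h2
      exact ⟨4 * n + 1 + 2, by rw [wP_eq]; exact h2⟩

theorem cons_integ_append (p q s : Bool) (d : List Bool) :
    p :: (integ s d ++ [q]) = integ p (xor p s :: (d ++ [xor (endBit s d) q])) := by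
  rw [integ, integ_append_cons]
  simp [integ]

theorem IsFactor.of_infix {v w : Word} (hw : IsFactor uP w) (h : v <:+: w) : IsFactor uP v := by
  rw [isFactor_uP_iff_exists_infix] at *
  obtain ⟨n, hn⟩ := hw
  exact ⟨n, h.trans hn⟩

theorem isBispecial_of_bilateralExt {v : Word}
    (h : bilateralExt uP v = {(false, true), (true, false)} ∨
      bilateralExt uP v = {(false, false), (true, true)}) : IsBispecial uP v := by
  have h1 : ∀ p, ∃ q, (p, q) ∈ bilateralExt uP v := by
    intro p
    rcases h with h | h <;> rw [h]
    · exact ⟨!p, by cases p <;> simp⟩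
    · exact ⟨p, by cases p <;> simp⟩
  have h2 : ∀ q, ∃ p, (p, q) ∈ bilateralExt uP v := by
    intro p
    rcases h with h | h <;> rw [h]
    · exact ⟨!p, by cases p <;> simp⟩
    · exact ⟨p, by cases p <;> simp⟩
  have h3 : ∀ p, IsFactor uP (p :: v) := fun p => by
    obtain ⟨q, hq⟩ := h1 p
    exact IsFactor.of_infix hq ⟨[], [q], by simp⟩
  have h4 : ∀ q, IsFactor uP (v ++ [q]) := fun q => by
    obtain ⟨p, hp⟩ := h2 q
    exact IsFactor.of_infix hp ⟨[p], [], by simp⟩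
  exact ⟨(h3 true).of_infix (List.suffix_cons true v).isInfix, ⟨h3 _, h3 _⟩, ⟨h4 _, h4 _⟩⟩

/-- Outer letters and outer differences differ by the fixed end letters of the word, which only
changes the constant in the definition of weakness. -/
theorem isWeakBispecial_integ_iff (s : Bool) (d : List Bool) :
    IsWeakBispecial uP (integ s d) ↔
      IsWeakFor (RetLang morTau [true, true, true] palPsi) id d := by
  have hmem : ∀ p q, (p, q) ∈ bilateralExt uP (integ s d) ↔
      RetLang morTau [true, true, true] palPsi (xor p s :: (d ++ [xor (endBit s d) q])) := by
    intro p q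
    rw [← isFactor_uP_integ_iff p, ← cons_integ_append]
    rfl
  have hset : ∀ c, (∀ p q, (p, q) ∈ bilateralExt uP (integ s d) ↔ xor p q = c) ↔
      bilateralExt uP (integ s d) = if c then {(false, true), (true, false)} else
        {(false, false), (true, true)} := by
    intro c
    rw [Set.ext_iff, Prod.forall]
    refine forall_congr' fun p => forall_congr' fun q => ?_
    have : xor p q = c ↔ (p, q) ∈ (if c then {(false, true), (true, false)} else
        {(false, false), (true, true)} : Set (Bool × Bool)) := by
      cases p <;> cases q <;> cases c <;> simp
    rw [this]
  have hweak : IsWeakBispecial uP (integ s d) ↔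
      ∃ c, ∀ p q, (p, q) ∈ bilateralExt uP (integ s d) ↔ xor p q = c := by
    constructor
    · rintro ⟨-, h | h⟩
      · exact ⟨true, (hset true).2 h⟩
      · exact ⟨false, (hset false).2 h⟩
    · rintro ⟨c, hc⟩
      have h := (hset c).1 hc
      have h' : bilateralExt uP (integ s d) = {(false, true), (true, false)} ∨
          bilateralExt uP (integ s d) = {(false, false), (true, true)} := by
        cases c
        · exact Or.inr h
        · exact Or.inl h
      exact ⟨isBispecial_of_bilateralExt h', h'⟩
  rw [hweak]
  have hS : ∀ i j, (∃ p q, id p = i ∧ id q = j ∧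
      RetLang morTau [true, true, true] palPsi (p :: (d ++ [q]))) ↔
      (xor i s, xor (endBit s d) j) ∈ bilateralExt uP (integ s d) := by
    intro i j
    rw [hmem, Bool.xor_assoc, Bool.xor_self, Bool.xor_false, ← Bool.xor_assoc, Bool.xor_self,
      Bool.false_xor]
    constructor
    · rintro ⟨_, _, rfl, rfl, h⟩
      exact h
    · intro h
      exact ⟨i, j, rfl, rfl, h⟩
  unfold IsWeakFor
  simp only [hS]
  generalize endBit s d = t
  constructor
  · rintro ⟨c, hc⟩
    refine ⟨xor c (xor s t), fun i j => ?_⟩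
    rw [hc]
    cases i <;> cases j <;> cases s <;> cases t <;> cases c <;> simp
  · rintro ⟨c, hc⟩
    refine ⟨xor c (xor s t), fun p q => ?_⟩
    have := hc (xor p s) (xor t q)
    rw [Bool.xor_assoc, Bool.xor_self, Bool.xor_false, ← Bool.xor_assoc, Bool.xor_self,
      Bool.false_xor] at this
    rw [this]
    cases p <;> cases q <;> cases s <;> cases t <;> cases c <;> simp

theorem not_isWeakBispecial_nil : ¬ IsWeakBispecial uP [] := by
  have hmem : ∀ q, (true, q) ∈ bilateralExt uP [] := by
    intro q
    refine isFactor_uP_iff_exists_infix.2 ⟨7, ?_⟩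
    rw [wP_eq]
    revert q
    decide
  rintro ⟨-, h | h⟩
  · have := hmem true
    rw [h] at this
    simp at this
  · have := hmem false
    rw [h] at this
    simp at this

theorem isWeakBispecial_iff (v : Word) :
    IsWeakBispecial uP v ↔ ∃ s n, v = integ s (weakDiff n) := by
  constructor
  · intro h
    rcases eq_or_ne v [] with rfl | hv
    · exact absurd h not_isWeakBispecial_nil
    · obtain ⟨s, d, rfl⟩ := exists_eq_integ hv
      obtain ⟨n, rfl⟩ := (isWeakFor_tau_iff d).1 ((isWeakBispecial_integ_iff s d).1 h)
      exact ⟨s, n, rfl⟩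
  · rintro ⟨s, n, rfl⟩
    exact (isWeakBispecial_integ_iff _ _).2 ((isWeakFor_tau_iff _).2 ⟨n, rfl⟩)

/-! ### The words `s_{2k+1}` -/

/-- The word `R(A) B⁻¹ C B⁻¹ A`, for a common prefix `B` of `A` and `C`. -/
def conjMul {β : Type*} (A B C : List β) : List β :=
  A.reverse ++ (C.drop B.length ++ A.drop B.length)

theorem IsReturnMorphism.conjMul_retWord {α β : Type*} {M : α → List β} {G : List β}
    (hM : IsReturnMorphism M G) {a b c : List α} (ha : b <+: a) (hc : b <+: c) :
    conjMul (retWord M G a) (retWord M G b) (retWord M G c) = retWord M G (conjMul a b c) := by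
  obtain ⟨y, rfl⟩ := ha
  obtain ⟨z, rfl⟩ := hc
  have hdrop : ∀ y, ∃ y', retWord M G y = G ++ y' ∧
      (retWord M G (b ++ y)).drop (retWord M G b).length = y' := by
    intro y
    obtain ⟨y', hy'⟩ := hM.prefix_retWord y
    refine ⟨y', hy'.symm, ?_⟩
    rw [retWord_append, ← hy', ← List.append_assoc]
    exact List.drop_left' rfl
  obtain ⟨y', hy, hy'⟩ := hdrop y
  obtain ⟨z', hz, hz'⟩ := hdrop z
  rw [conjMul, conjMul, hM.reverse_retWord, hy', hz', List.drop_left, List.drop_left,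
    retWord_append, retWord_append, hy, ← List.append_assoc (z.flatMap M)]
  have : z.flatMap M ++ G = G ++ z' := hz
  rw [this]
  simp [retWord]

theorem conjMul_palPsi (m : ℕ) :
    conjMul (palPsi (2 * m + 1)) (palPsi (2 * m)) (palPsi (2 * m + 3)) = weakPsi m := by
  induction m with
  | zero => decide
  | succ m ih =>
    rw [weakPsi, ← ih, ← isReturnMorphism_morPsi.conjMul_retWord
      (palPsi_prefix_of_le (by omega)) (palPsi_prefix_of_le (by omega))]
    rfl

/-- The image of `A` under `t`, the word `B` and the word `C` all end in the same letter, so the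
differences at both junctions are those of the glued difference sequences. -/
theorem cancelMul_app_eq_integ {t : Anti} {dA dB dC : List Bool} (hA : dB <+: dA)
    (hC : dB <+: dC) (hB : endBit true dB = !t.flips) (hC' : endBit true dC = !t.flips) :
    cancelMul (cancelMul (t.app (integ true dA)) (integ true dB) (integ true dC))
      (integ true dB) (integ true dA) =
      integ (xor (endBit true dA) t.flips) (conjMul dA dB dC) ∧
    endBit (xor (endBit true dA) t.flips) (conjMul dA dB dC) = endBit true dA := by
  obtain ⟨y, rfl⟩ := hA
  obtain ⟨z, rfl⟩ := hC
  rw [endBit_append, hB] at hC'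
  have hs : endBit (xor (endBit true (dB ++ y)) t.flips) (dB ++ y).reverse = !t.flips := by
    rw [endBit_xor, endBit_reverse, Bool.true_xor]
  have hdrop : ∀ x, (integ true (dB ++ x)).drop (integ true dB).length =
      (integ (!t.flips) x).tail := by
    intro x
    rw [integ_append, hB]
    exact List.drop_left' rfl
  have h1 := fun x : List Bool => List.drop_left' (l₂ := x) (rfl : dB.length = dB.length)
  rw [cancelMul, cancelMul, hdrop, hdrop, conjMul, h1, h1, app_integ]
  generalize hs₀ : xor (endBit true (dB ++ y)) t.flips = s₀ at *
  constructor
  · rw [← List.append_assoc _ z, integ_append _ (_ ++ z), integ_append _ _ z, endBit_append, hs,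
      hC']
  · rw [endBit_append, endBit_append, hs, hC', endBit_append, hB]

theorem isPal_of_endBit {t : Anti} {b : Bool} {d : List Bool} (hd : d.reverse = d)
    (h : endBit (xor b t.flips) d = b) : IsPal t (integ (xor b t.flips) d) := by
  rw [isPal_integ_iff, h, Bool.xor_assoc, Bool.xor_self, Bool.xor_false]
  exact ⟨rfl, hd⟩

theorem sP_aux (m : ℕ) {t : Anti} (ht : t = thetaP (2 * m + 1)) :
    ∃ s, cancelMul (cancelMul (t.app (wP (2 * m + 3))) (wP (2 * m + 2)) (wP (2 * m + 5)))
      (wP (2 * m + 2)) (wP (2 * m + 3)) = integ s (weakDiff (m + 1)) ∧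
      IsPal t (integ s (weakDiff (m + 1))) := by
  have hC' : thetaP (2 * m + 3 + 1) = thetaP (2 * m + 1) := by
    unfold thetaP
    have : (2 * m) % 4 = 0 ∨ (2 * m) % 4 = 2 := by omega
    rcases this with h | h
    · rw [if_pos (by omega), if_pos (by omega)]
    · rw [if_neg (by omega), if_neg (by omega)]
  have hpre : ∀ {i j}, i ≤ j → prefDiff i <+: prefDiff j := fun h =>
    (integ_prefix_iff.1 (palWord_prefix_of_le h)).2
  obtain ⟨h1, h2⟩ := cancelMul_app_eq_integ (t := t) (dA := prefDiff (2 * m + 1))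
    (dB := prefDiff (2 * m)) (dC := prefDiff (2 * m + 3)) (hpre (by omega)) (hpre (by omega))
    (by rw [endBit_prefDiff_eq_flips, ht]) (by rw [endBit_prefDiff_eq_flips, hC', ht])
  have h3 : conjMul (prefDiff (2 * m + 1)) (prefDiff (2 * m)) (prefDiff (2 * m + 3)) =
      weakDiff (m + 1) := by
    rw [prefDiff, prefDiff, prefDiff, isReturnMorphism_morTau.conjMul_retWord
      (palPsi_prefix_of_le (by omega)) (palPsi_prefix_of_le (by omega)), conjMul_palPsi]
    rfl
  rw [h3] at h1 h2
  refine ⟨_, ?_, isPal_of_endBit (reverse_weakDiff _) h2⟩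
  rw [wP_eq (2 * m + 1), wP_eq (2 * m), wP_eq (2 * m + 3)]
  exact h1

/-- The words `s_{2k+1}` have the difference sequences `weakDiff (k - 2)`. -/
theorem sP_eq (n : ℕ) : ∃ s, sP (2 * (n + 2) + 1) = integ s (weakDiff n) ∧
    IsPal (if n % 2 = 0 then Anti.R else Anti.E) (integ s (weakDiff n)) := by
  cases n with
  | zero =>
    -- The word `s_5` involves `w_0` and `w_1`, which are not of the form `palWord j`; it is
    -- computed explicitly and begins with `0`.
    refine ⟨false, ?_, by decide⟩
    have h0 : wP 0 = [] := rfl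
    rw [sP, if_pos (by decide), show (2 * (0 + 2) + 1) / 4 = 1 by decide, sOne,
      show 4 * (1 - 1) + 1 = 1 by decide, show 4 * (1 - 1) = 0 by decide,
      show 0 + 3 = 1 + 2 by decide, wP_one, h0, wP_eq]
    decide
  | succ m =>
    have hm : m % 2 = 0 ∨ m % 2 = 1 := by omega
    rcases hm with hm | hm
    · rw [if_neg (by omega)]
      have h := sP_aux m (t := Anti.E) (by rw [thetaP, if_pos (by omega)])
      rw [sP, if_neg (by omega), sThree,
        show 4 * ((2 * (m + 1 + 2) + 1) / 4 - 1) + 3 = 2 * m + 3 by omega,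
        show 4 * ((2 * (m + 1 + 2) + 1) / 4) - 2 = 2 * m + 2 by omega,
        show 4 * ((2 * (m + 1 + 2) + 1) / 4) + 1 = 2 * m + 5 by omega]
      exact h
    · rw [if_pos (by omega)]
      have h := sP_aux m (t := Anti.R) (by rw [thetaP, if_neg (by omega)])
      rw [sP, if_pos (by omega), sOne,
        show 4 * ((2 * (m + 1 + 2) + 1) / 4 - 1) + 1 = 2 * m + 3 by omega,
        show 4 * ((2 * (m + 1 + 2) + 1) / 4 - 1) + 3 = 2 * m + 5 by omega,
        show 4 * ((2 * (m + 1 + 2) + 1) / 4 - 1) = 2 * m + 2 by omega]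
      exact h

end Pseudostandard

theorem mainTheorem2 :
    (∀ k : ℕ, 2 ≤ k →
      (Even k → Pseudostandard.IsPal Pseudostandard.Anti.R (Pseudostandard.sP (2 * k + 1))) ∧
      (Odd k → Pseudostandard.IsPal Pseudostandard.Anti.E (Pseudostandard.sP (2 * k + 1))) ∧
      Pseudostandard.IsWeakBispecial Pseudostandard.uP (Pseudostandard.sP (2 * k + 1))) ∧
    (∀ v : Pseudostandard.Word,
      Pseudostandard.IsWeakBispecial Pseudostandard.uP v ↔
        ∃ k : ℕ, 2 ≤ k ∧
          (v = Pseudostandard.sP (2 * k + 1) ∨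
            v = Pseudostandard.Anti.R.app (Pseudostandard.sP (2 * k + 1)) ∨
            v = Pseudostandard.Anti.E.app (Pseudostandard.sP (2 * k + 1)))) := by
  open Pseudostandard in
  constructor
  · intro k hk
    obtain ⟨n, rfl⟩ : ∃ n, k = n + 2 := ⟨k - 2, by omega⟩
    obtain ⟨s, h1, h2⟩ := sP_eq n
    rw [h1]
    refine ⟨fun h => ?_, fun h => ?_, (isWeakBispecial_iff _).2 ⟨s, n, rfl⟩⟩
    · rwa [if_pos (by rw [Nat.even_iff] at h; omega)] at h2
    · rwa [if_neg (by rw [Nat.odd_iff] at h; omega)] at h2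
  · intro v
    rw [isWeakBispecial_iff]
    constructor
    · rintro ⟨s, n, rfl⟩
      obtain ⟨s', h1, -⟩ := sP_eq n
      -- The images under `R` and `E` already cover both first letters, so the word itself is not
      -- needed.
      refine ⟨n + 2, by omega, Or.inr ?_⟩
      rw [h1, app_integ, app_integ, reverse_weakDiff]
      cases s <;> cases endBit s' (weakDiff n) <;> simp [Anti.flips]
    · rintro ⟨k, hk, h⟩
      obtain ⟨n, rfl⟩ : ∃ n, k = n + 2 := ⟨k - 2, by omega⟩
      obtain ⟨s', h1, -⟩ := sP_eq n
      rw [h1, app_integ, app_integ, reverse_weakDiff] at h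
      rcases h with rfl | rfl | rfl <;> exact ⟨_, n, rfl⟩
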